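/- Let $d\ge 3$. To a tensor $\mathbf C=(C_{ijkl})_{1\le i,j,k,l\le d}$ of real numbers with the symmetries $C_{ijkl}=C_{kjil}=C_{ilkj}$ associate the quadratic form $f(\xi)=\sum_{i,j,k,l}C_{ijkl}\,\xi_{ij}\xi_{kl}$ on $\mathbb R^{d\times d}$ and its acoustic tensor $T(y)\in\mathbb R^{d\times d}$, $T(y)_{ik}=\sum_{j,l}C_{ijkl}\,y_jy_l$ for $y\in\mathbb R^d$, so that $f(x\otimes y)=x^{T}T(y)x$, where $(x\otimes y)_{ij}=x_iy_j$. The form $f$ is called quasiconvex if $f(\xi)\le\int_{[0,1]^d}f(\xi+\nabla\varphi(x))\,dx$ for all $\xi\in\mathbb R^{d\times d}$ and all $\varphi\in W^{1,\infty}_0([0,1]^d,\mathbb R^d)$ (Lipschitz maps vanishing on the boundary of the cube), and polyconvex if there is a convex function $g$ of finitely many real variables such that, for all $\xi$, $f(\xi)=g(M_1(\xi),\dots,M_K(\xi))$, where $M_1,\dots,M_K$ are all the minors of $\xi$, of all orders $1,\dots,d$. **Theorem 2.2.** Let $d=3$, let $f$ be quasiconvex, and assume that $\det T(y)=0$ for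 all $y\in\mathbb R^3$. Then $f$ is polyconvex, and the biquadratic form $x^{T}T(y)x$ is a finite sum of squares of bilinear forms in $(x,y)$. The statement fails in every dimension $d\ge 4$: for each such $d$ there is a tensor $\mathbf C$ with the above symmetries whose form $f$ is quasiconvex and satisfies $\det T(y)=0$ for all $y\in\mathbb R^d$, but $f$ is not polyconvex and $x^{T}T(y)x$ is not a finite sum of squares of bilinear forms. -/

import Mathlib

open MeasureTheory
open scoped Matrix

/-! ### Quasiconvexity -/

/-- The closed unit cube `[0,1]^n` in `ℝ^n`. -/
def unitCube (n : ℕ) : Set (EuclideanSpace ℝ (Fin n)) :=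
  {x | ∀ j, x j ∈ Set.Icc (0 : ℝ) 1}

/-- The space `W_0^{1,∞}([0,1]^n, ℝ^N)` of test fields: the Lipschitz functions that vanish on the
boundary of the unit cube, extended by zero to `ℝ^n`.  (On a cube the elements of `W^{1,∞}` are,
up to equality almost everywhere, exactly the Lipschitz functions.) -/
def IsTestField {N n : ℕ} (φ : EuclideanSpace ℝ (Fin n) → EuclideanSpace ℝ (Fin N)) : Prop :=
  (∃ K : NNReal, LipschitzWith K φ) ∧
    ∀ x, (¬ ∀ j, x j ∈ Set.Ioo (0 : ℝ) 1) → φ x = 0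

/-- The `N × n` gradient matrix `(∇φ)_{ij} = ∂φ_i / ∂x_j`.  For a test field it exists at almost
every point, by Rademacher's theorem. -/
noncomputable def gradientMatrix {N n : ℕ}
    (φ : EuclideanSpace ℝ (Fin n) → EuclideanSpace ℝ (Fin N))
    (x : EuclideanSpace ℝ (Fin n)) : Matrix (Fin N) (Fin n) ℝ :=
  Matrix.of fun i j => (fderiv ℝ φ x (EuclideanSpace.single j 1)) i

/-- Quasiconvexity in the sense of Morrey:
`f ξ ≤ ∫_{[0,1]^n} f (ξ + ∇φ(x)) dx` for all matrices `ξ` and all `φ ∈ W_0^{1,∞}`.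
It is meant for Borel measurable, locally bounded `f` (such as quadratic forms), for which the
integrand is bounded and measurable, hence integrable. -/
def IsQuasiconvex {N n : ℕ} (f : Matrix (Fin N) (Fin n) ℝ → ℝ) : Prop :=
  ∀ (ξ : Matrix (Fin N) (Fin n) ℝ)
    (φ : EuclideanSpace ℝ (Fin n) → EuclideanSpace ℝ (Fin N)), IsTestField φ →
      f ξ ≤ ∫ x in unitCube n, f (ξ + gradientMatrix φ x)

/-! ### Polyconvexity -/

/-- Indices of the minors of a `d × d` matrix: an order `r + 1` with `1 ≤ r + 1 ≤ d`, a choice of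
`r + 1` rows and a choice of `r + 1` columns, both listed increasingly. -/
abbrev MinorIndex (d : ℕ) : Type :=
  Σ r : Fin d, (Fin (r.val + 1) ↪o Fin d) × (Fin (r.val + 1) ↪o Fin d)

/-- The list of all minors (of all orders `1, …, d`) of a `d × d` matrix. -/
noncomputable def minors {d : ℕ} (ξ : Matrix (Fin d) (Fin d) ℝ) : MinorIndex d → ℝ :=
  fun s => (ξ.submatrix s.2.1 s.2.2).det

/-- Polyconvexity in the sense of Ball: `f` is a convex function of the list of all minors. -/
def IsPolyconvex {d : ℕ} (f : Matrix (Fin d) (Fin d) ℝ → ℝ) : Prop :=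
  ∃ g : (MinorIndex d → ℝ) → ℝ, ConvexOn ℝ Set.univ g ∧ ∀ ξ, f ξ = g (minors ξ)

/-! ### Fourth order tensors, their quadratic forms and acoustic tensors -/

/-- Fourth order tensors `C = (C_{ijkl})` in `(ℝ^d)^4`. -/
abbrev Tensor4 (d : ℕ) : Type := Fin d → Fin d → Fin d → Fin d → ℝ

/-- The usual symmetries `C_{ijkl} = C_{kjil} = C_{ilkj}`. -/
def HasUsualSymmetries {d : ℕ} (C : Tensor4 d) : Prop :=
  ∀ i j k l, C i j k l = C k j i l ∧ C i j k l = C i l k j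

/-- The quadratic form `f(ξ) = ∑_{i,j,k,l} C_{ijkl} ξ_{ij} ξ_{kl}`. -/
def tensorForm {d : ℕ} (C : Tensor4 d) (ξ : Matrix (Fin d) (Fin d) ℝ) : ℝ :=
  ∑ i, ∑ j, ∑ k, ∑ l, C i j k l * ξ i j * ξ k l

/-- The acoustic tensor (`y`-matrix) `T(y)_{ik} = ∑_{j,l} C_{ijkl} y_j y_l`, so that
`f(x ⊗ y) = xᵀ T(y) x`. -/
def acousticTensor {d : ℕ} (C : Tensor4 d) (y : Fin d → ℝ) : Matrix (Fin d) (Fin d) ℝ :=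
  Matrix.of fun i k => ∑ j, ∑ l, C i j k l * y j * y l

/-- The biquadratic form `xᵀ T(y) x` is a finite sum of squares of bilinear forms `xᵀ B y`. -/
def IsSumOfSquaresOfBilinear {d : ℕ} (C : Tensor4 d) : Prop :=
  ∃ (m : ℕ) (B : Fin m → Matrix (Fin d) (Fin d) ℝ), ∀ x y : Fin d → ℝ,
    x ⬝ᵥ (acousticTensor C y *ᵥ x) = ∑ s, (x ⬝ᵥ (B s *ᵥ y)) ^ 2

/-!
For a quadratic form on matrices, quasiconvexity is the same as nonnegativity of the biquadratic
form `xᵀ T(y) x`: one direction is Plancherel's theorem for smooth test fields and mollification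
(`isQuasiconvex_tensorForm`), the other tests with rapidly oscillating fields of fixed direction
(`IsQuasiconvex.biq_nonneg`). If the biquadratic form is a sum of squares of bilinear forms, then
`f` is a sum of squares of linear forms plus a combination of minors of order two, hence polyconvex
(`IsSumOfSquaresOfBilinear.isPolyconvex`).

**Dimension at least four.** Extend by zero a Choi form on `ℝ³ × ℝ³`, which is nonnegative. Matrices
`± Aₐ` whose minors average to zero while the form has a negative average show that it is not
polyconvex, and so not a sum of squares (`exists_counterexample`).

**Dimension three.** Subtract from the biquadratic form a sum of squares of maximal trace. The
remainder is nonnegative, its determinant still vanishes, and no nonzero square lies below it; so it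
suffices that a nonzero nonnegative form with `det T ≡ 0` dominates the square of some nonzero
bilinear form (`isSumOfSquaresOfBilinear_of_hasSquareBelow`). Suppose it does not. Write `S(x)` for
the matrix of the form with the roles of `x` and `y` exchanged; `T(y) x = 0` if and only if
`S(x) y = 0`.

* No `T(y)` and no `S(x)` has rank one (`hasSquareBelow_of_rankOne`).
* If `T(y)` has rank two for all `y ≠ 0` and `B y` is always in the range of `T(y)`, then by
  compactness a multiple of `(xᵀ B y)²` lies below the form (`hasSquareBelow_of_adjugate_mulVec`).
  This, and its variant on a plane, deals with the cases where `T` or `S` has a nontrivial zero.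
* Otherwise `T(y)` has rank two for `y ≠ 0`, so its adjugate is a symmetric rank-one matrix of
  quartic forms without common real zeros other than the origin. By unique factorisation it is
  `c v vᵀ` with a kernel vector `v` that is constant, linear or quadratic in `y`
  (`adjugate_acousticTensor_trichotomy`). A constant `v` is a zero of `S`; a linear `v = A y`
  admits a `B` with `B y ⊥ A y`.
* Let `v` be quadratic. If some `S(x₀)` is definite, with quadratic form `q`, then
  `q(y) (xᵀ T(y) x)` is the sum of the squares of two quadratic forms in `y`. The conic `q = 0` is a
  rational curve without real points, so both are multiples of `q`, and `v` is `q` times a constant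
  vector (`exists_eq_mul_of_sq_add_sq`, `exists_common_kernel_of_quadratic`).
* If all `S(x)` are singular, the kernel `w` of `S` is quadratic too, by the same trichotomy, and
  `w(v(y))` is a nonzero multiple of `y` for `y ≠ 0`. But `y · w(v(y))` is odd, so it has a zero on
  the connected set `y ≠ 0` (`false_of_quadratic_kernels`).
-/

theorem dotProduct_acousticTensor_mulVec {d : ℕ} (C : Tensor4 d) (x y : Fin d → ℝ) :
    x ⬝ᵥ (acousticTensor C y *ᵥ x) = ∑ i, ∑ j, ∑ k, ∑ l, C i j k l * (x i * y j) * (x k * y l) := by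
  simp only [dotProduct, Matrix.mulVec, acousticTensor, Matrix.of_apply, Finset.mul_sum,
    Finset.sum_mul]
  refine Finset.sum_congr rfl fun i _ => ?_
  rw [Finset.sum_comm]
  refine Finset.sum_congr rfl fun j _ => Finset.sum_congr rfl fun k _ =>
    Finset.sum_congr rfl fun l _ => by ring

theorem tensorForm_vecMulVec {d : ℕ} (C : Tensor4 d) (x y : Fin d → ℝ) :
    tensorForm C (Matrix.vecMulVec x y) = x ⬝ᵥ (acousticTensor C y *ᵥ x) := by
  rw [dotProduct_acousticTensor_mulVec]
  simp only [tensorForm, Matrix.vecMulVec_apply]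

/-! ### Constant-coefficient quadratic forms of smooth gradients -/

section Plancherel

open SchwartzMap FourierTransform LineDeriv Complex
open scoped ComplexInnerProductSpace

variable {d : ℕ}

theorem fourier_lineDerivOp_apply (u : 𝓢(EuclideanSpace ℝ (Fin d), ℂ)) (j : Fin d)
    (w : EuclideanSpace ℝ (Fin d)) :
    (𝓕 (∂_{EuclideanSpace.single j (1 : ℝ)} u)) w = (2 * Real.pi * I) * ((w j : ℂ) * (𝓕 u) w) := by
  have h : (inner ℝ · (EuclideanSpace.single j (1 : ℝ)) :
    EuclideanSpace ℝ (Fin d) → ℝ).HasTemperateGrowth := by fun_prop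
  rw [fourier_lineDerivOp_eq]
  rw [_root_.smul_apply, smulLeftCLM_apply_apply h]
  simp [EuclideanSpace.inner_single_right]

theorem integral_sum₄ {α : Type*} [MeasurableSpace α] {μ : Measure α}
    (F : Fin d → Fin d → Fin d → Fin d → α → ℝ) (hF : ∀ i j k l, Integrable (F i j k l) μ) :
    ∫ z, ∑ i, ∑ j, ∑ k, ∑ l, F i j k l z ∂μ = ∑ i, ∑ j, ∑ k, ∑ l, ∫ z, F i j k l z ∂μ := by
  rw [integral_finsetSum _ fun i _ => integrable_finsetSum _ fun j _ =>
    integrable_finsetSum _ fun k _ => integrable_finsetSum _ fun l _ => hF i j k l]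
  refine Finset.sum_congr rfl fun i _ => ?_
  rw [integral_finsetSum _ fun j _ =>
    integrable_finsetSum _ fun k _ => integrable_finsetSum _ fun l _ => hF i j k l]
  refine Finset.sum_congr rfl fun j _ => ?_
  rw [integral_finsetSum _ fun k _ => integrable_finsetSum _ fun l _ => hF i j k l]
  refine Finset.sum_congr rfl fun k _ => ?_
  rw [integral_finsetSum _ fun l _ => hF i j k l]

theorem re_inner_add_im (C : Tensor4 d) (v : Fin d → ℂ) (w : Fin d → ℝ) :
    (∑ i, ∑ j, ∑ k, ∑ l, C i j k l *
      (⟪(2 * Real.pi * I) * ((w j : ℂ) * v i), (2 * Real.pi * I) * ((w l : ℂ) * v k)⟫).re) =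
    (2 * Real.pi) ^ 2 * ((fun i => (v i).re) ⬝ᵥ (acousticTensor C w *ᵥ fun i => (v i).re) +
      (fun i => (v i).im) ⬝ᵥ (acousticTensor C w *ᵥ fun i => (v i).im)) := by
  rw [dotProduct_acousticTensor_mulVec, dotProduct_acousticTensor_mulVec]
  simp only [← Finset.sum_add_distrib, Finset.mul_sum]
  refine Finset.sum_congr rfl fun i _ => Finset.sum_congr rfl fun j _ =>
    Finset.sum_congr rfl fun k _ => Finset.sum_congr rfl fun l _ => ?_
  simp
  ring

theorem integrable_inner_schwartz (f g : 𝓢(EuclideanSpace ℝ (Fin d), ℂ)) :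
    Integrable (fun z => ⟪f z, g z⟫) := by
  refine (L2.integrable_inner (𝕜 := ℂ) (f.toLp 2 volume) (g.toLp 2 volume)).congr ?_
  filter_upwards [f.coeFn_toLp 2 volume, g.coeFn_toLp 2 volume] with z hf hg
  rw [hf, hg]

/-- By Plancherel's theorem, the integral of a quadratic form of the gradient is an integral over
frequencies `w` of its values at the rank-one matrices `(𝓕 u)(w) ⊗ w`. -/
theorem sum_integral_lineDeriv_nonneg (C : Tensor4 d)
    (hC : ∀ x y, 0 ≤ x ⬝ᵥ (acousticTensor C y *ᵥ x))
    (u : Fin d → 𝓢(EuclideanSpace ℝ (Fin d), ℂ)) :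
    0 ≤ ∑ i, ∑ j, ∑ k, ∑ l, C i j k l *
      (∫ z, ⟪(∂_{EuclideanSpace.single j (1 : ℝ)} (u i)) z,
        (∂_{EuclideanSpace.single l (1 : ℝ)} (u k)) z⟫).re := by
  let F : Fin d → Fin d → Fin d → Fin d → EuclideanSpace ℝ (Fin d) → ℝ := fun i j k l z =>
    C i j k l * (⟪(𝓕 (∂_{EuclideanSpace.single j (1 : ℝ)} (u i))) z,
        (𝓕 (∂_{EuclideanSpace.single l (1 : ℝ)} (u k))) z⟫).re
  have hF : ∀ i j k l, Integrable (F i j k l) := fun i j k l =>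
    ((integrable_inner_schwartz _ _).re).const_mul _
  have hre : ∀ i j k l, C i j k l *
      (∫ z, ⟪(∂_{EuclideanSpace.single j (1 : ℝ)} (u i)) z,
        (∂_{EuclideanSpace.single l (1 : ℝ)} (u k)) z⟫).re = ∫ z, F i j k l z := by
    intro i j k l
    rw [← integral_inner_fourier_fourier, integral_const_mul]
    congr 1
    exact (integral_re (integrable_inner_schwartz _ _)).symm
  simp only [hre]
  rw [← integral_sum₄ F hF]
  refine integral_nonneg fun w => ?_
  have h3 := re_inner_add_im C (fun i => (𝓕 (u i)) w) (fun j => w j)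
  simp only [F, fourier_lineDerivOp_apply, Pi.zero_apply]
  rw [h3]
  have h1 := hC (fun i => ((𝓕 (u i)) w).re) (fun j => w j)
  have h2 := hC (fun i => ((𝓕 (u i)) w).im) (fun j => w j)
  positivity

end Plancherel

/-! ### Mollification of Lipschitz functions -/

section Mollification
open Filter Topology Metric
open scoped Convolution ContDiff NNReal

variable {E : Type*} [NormedAddCommGroup E] [NormedSpace ℝ E] [FiniteDimensional ℝ E]
  [MeasurableSpace E] [BorelSpace E] {μ : Measure E} [μ.IsAddHaarMeasure]

/-- The derivative of a mollified Lipschitz function is the mollification of its almost everywhere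
defined directional derivative. -/
theorem fderiv_convolution_lipschitz {u ρ : E → ℝ} {K : ℝ≥0} (hu : LipschitzWith K u)
    (hρ : ContDiff ℝ ∞ ρ) (hρc : HasCompactSupport ρ) (x v : E) :
    fderiv ℝ (ρ ⋆[ContinuousLinearMap.lsmul ℝ ℝ, μ] u) x v =
      (ρ ⋆[ContinuousLinearMap.lsmul ℝ ℝ, μ] fun z => lineDeriv ℝ u z v) x := by
  have hloc : LocallyIntegrable u μ := hu.continuous.locallyIntegrable
  have hsm : ContDiff ℝ ∞ (ρ ⋆[ContinuousLinearMap.lsmul ℝ ℝ, μ] u) :=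
    hρc.contDiff_convolution_left _ hρ hloc
  have hcx : HasCompactSupport fun t => ρ (x - t) :=
    hρc.comp_homeomorph (Homeomorph.subLeft x)
  have hρx : Integrable (fun t => ρ (x - t)) μ :=
    (hρ.continuous.comp (continuous_const.sub continuous_id)).integrable_of_hasCompactSupport hcx
  have h1 := hu.integral_inv_smul_sub_mul_tendsto_integral_lineDeriv_mul hρx v
  have hd : DifferentiableAt ℝ (ρ ⋆[ContinuousLinearMap.lsmul ℝ ℝ, μ] u) x :=
    hsm.contDiffAt.differentiableAt (by simp)
  have h2 := (hd.hasFDerivAt.hasLineDerivAt v).tendsto_slope_zero_right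
  have hex : ∀ z, ConvolutionExistsAt ρ u z (ContinuousLinearMap.lsmul ℝ ℝ) μ := fun z =>
    hρc.convolutionExists_left _ hρ.continuous hloc z
  have hswap : ∀ z, (ρ ⋆[ContinuousLinearMap.lsmul ℝ ℝ, μ] u) z = ∫ t, u t * ρ (z - t) ∂μ := by
    intro z
    rw [convolution_eq_swap]
    simp [mul_comm]
  have hswapi : ∀ z, Integrable (fun t => u t * ρ (z - t)) μ := by
    intro z
    refine (hu.continuous.mul (hρ.continuous.comp
      (continuous_const.sub continuous_id))).integrable_of_hasCompactSupport ?_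
    exact (hρc.comp_homeomorph (Homeomorph.subLeft z)).mul_left
  have h3 : ∀ t : ℝ, ∫ z, t⁻¹ • (u (z + t • v) - u z) * ρ (x - z) ∂μ =
      t⁻¹ • ((ρ ⋆[ContinuousLinearMap.lsmul ℝ ℝ, μ] u) (x + t • v) -
        (ρ ⋆[ContinuousLinearMap.lsmul ℝ ℝ, μ] u) x) := by
    intro t
    rw [hswap, hswap, ← integral_add_right_eq_self (fun z => u z * ρ (x + t • v - z)) (t • v)]
    have e : ∀ z, x + t • v - (z + t • v) = x - z := fun z => by abel
    have hi := (hswapi (x + t • v)).comp_add_right (t • v)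
    simp only [e] at hi ⊢
    rw [← integral_sub hi (hswapi x), ← integral_smul]
    simp only [smul_eq_mul]
    congr 1; ext z; ring
  simp only [h3] at h1
  have h4 := tendsto_nhds_unique h2 h1
  rw [h4, convolution_eq_swap]
  simp [mul_comm]

/-- A compactly supported Lipschitz function is approximated by smooth functions with supports in a
common ball and the same bound on the directional derivatives, whose derivatives converge almost
everywhere. -/
theorem exists_smooth_approx {u : E → ℝ} {K : ℝ≥0} (hu : LipschitzWith K u)
    (hc : HasCompactSupport u) :
    ∃ (w : ℕ → E → ℝ) (R : ℝ), (∀ n, ContDiff ℝ ∞ (w n)) ∧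
      (∀ n, Function.support (w n) ⊆ closedBall 0 R) ∧
      (∀ n x v, ‖fderiv ℝ (w n) x v‖ ≤ K * ‖v‖) ∧
      ∀ v, ∀ᵐ x ∂μ, Tendsto (fun n => fderiv ℝ (w n) x v) atTop (𝓝 (fderiv ℝ u x v)) := by
  let b : ℕ → ContDiffBump (0 : E) := fun n =>
    ⟨1 / (n + 1), 2 / (n + 1), by positivity, by gcongr; norm_num⟩
  have hb0 : Tendsto (fun n => (b n).rOut) atTop (𝓝 0) := by
    have := (tendsto_one_div_add_atTop_nhds_zero_nat (𝕜 := ℝ)).const_mul 2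
    simpa [b, div_eq_mul_inv] using this
  obtain ⟨R, hR⟩ := hc.isBounded.subset_closedBall (0 : E)
  refine ⟨fun n => (b n).normed μ ⋆[ContinuousLinearMap.lsmul ℝ ℝ, μ] u, 2 + R, fun n => ?_,
    fun n => ?_, fun n x v => ?_, fun v => ?_⟩
  · exact (b n).hasCompactSupport_normed.contDiff_convolution_left _ (b n).contDiff_normed
      hu.continuous.locallyIntegrable
  · refine (support_convolution_subset _).trans ?_
    rintro _ ⟨p, hp, q, hq, rfl⟩
    have hp' := (b n).support_normed_eq (μ := μ) ▸ hp
    have hq' := hR (subset_tsupport _ hq)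
    rw [mem_ball_zero_iff] at hp'
    rw [mem_closedBall_zero_iff] at hq' ⊢
    have : (b n).rOut ≤ 2 := by
      simp only [b]
      rw [div_le_iff₀ (by positivity)]
      have : (0 : ℝ) ≤ n := n.cast_nonneg
      linarith
    exact (norm_add_le _ _).trans (by linarith)
  · rw [fderiv_convolution_lipschitz hu (b n).contDiff_normed (b n).hasCompactSupport_normed,
      convolution_def]
    calc ‖∫ t, (ContinuousLinearMap.lsmul ℝ ℝ) ((b n).normed μ t) (lineDeriv ℝ u (x - t) v) ∂μ‖
        ≤ ∫ t, (b n).normed μ t * (K * ‖v‖) ∂μ := by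
          refine norm_integral_le_of_norm_le ((b n).integrable_normed.mul_const _)
            (Eventually.of_forall fun t => ?_)
          simp only [ContinuousLinearMap.lsmul_apply, smul_eq_mul, norm_mul]
          rw [Real.norm_of_nonneg ((b n).nonneg_normed t)]
          exact mul_le_mul_of_nonneg_left (norm_lineDeriv_le_of_lipschitz ℝ hu)
            ((b n).nonneg_normed t)
      _ = K * ‖v‖ := by rw [integral_mul_const, (b n).integral_normed, one_mul]
  · have h1 := ContDiffBump.ae_convolution_tendsto_right_of_locallyIntegrable (K := 2) hb0
      (Eventually.of_forall fun n => by simp only [b]; apply le_of_eq; ring)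
      (hu.locallyIntegrable_lineDeriv (μ := μ) v)
    filter_upwards [h1, hu.ae_differentiableAt (μ := μ)] with x hx hdx
    simp only [fderiv_convolution_lipschitz hu (b _).contDiff_normed
      (b _).hasCompactSupport_normed]
    rwa [← hdx.lineDeriv_eq_fderiv]

theorem integral_fderiv_lipschitz_eq_zero {u : E → ℝ} {K : ℝ≥0} (hu : LipschitzWith K u)
    (hc : HasCompactSupport u) (v : E) : ∫ x, fderiv ℝ u x v ∂μ = 0 := by
  have h :=
    LipschitzWith.integral_lineDeriv_mul_eq (μ := μ) (LipschitzWith.const (1 : ℝ)) hu hc (-v)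
  rw [neg_neg] at h
  have h0 : ∀ x, lineDeriv ℝ (fun _ : E => (1 : ℝ)) x (-v) = 0 := fun x => by simp [lineDeriv]
  simp only [h0, zero_mul, integral_zero, mul_one] at h
  rw [h]
  refine integral_congr_ae ?_
  filter_upwards [hu.ae_differentiableAt (μ := μ)] with x hx
  rw [hx.lineDeriv_eq_fderiv]

end Mollification

/-! ### Rank-one nonnegativity implies quasiconvexity -/

section Quasiconvexity
open Filter Topology Metric SchwartzMap LineDeriv
open scoped ContDiff NNReal

variable {d : ℕ}

theorem sum_integral_fderiv_smooth_nonneg (C : Tensor4 d)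
    (hC : ∀ x y, 0 ≤ x ⬝ᵥ (acousticTensor C y *ᵥ x))
    (w : Fin d → EuclideanSpace ℝ (Fin d) → ℝ) (hw : ∀ i, ContDiff ℝ ∞ (w i))
    (hwc : ∀ i, HasCompactSupport (w i)) :
    0 ≤ ∑ i, ∑ j, ∑ k, ∑ l, C i j k l *
      ∫ z, fderiv ℝ (w i) z (EuclideanSpace.single j 1) *
        fderiv ℝ (w k) z (EuclideanSpace.single l 1) := by
  have hs : ∀ i, HasCompactSupport fun z => (w i z : ℂ) := fun i =>
    (hwc i).comp_left Complex.ofReal_zero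
  have hd : ∀ i, ContDiff ℝ ∞ fun z => (w i z : ℂ) := fun i =>
    Complex.ofRealCLM.contDiff.comp (hw i)
  have h := sum_integral_lineDeriv_nonneg C hC fun i => (hs i).toSchwartzMap (hd i)
  have hder : ∀ i j z, (∂_{EuclideanSpace.single j (1 : ℝ)} ((hs i).toSchwartzMap (hd i)) :
      𝓢(EuclideanSpace ℝ (Fin d), ℂ)) z =
      ((fderiv ℝ (w i) z (EuclideanSpace.single j 1) : ℝ) : ℂ) := by
    intro i j z
    rw [SchwartzMap.lineDerivOp_apply_eq_fderiv]
    have h1 : HasFDerivAt (w i) (fderiv ℝ (w i) z) z :=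
      ((hw i).contDiffAt.differentiableAt (by simp)).hasFDerivAt
    have h2 := (Complex.ofRealCLM.hasFDerivAt (x := w i z)).comp z h1
    change fderiv ℝ (fun z => (w i z : ℂ)) z _ = _
    exact congrArg (fun L => L (EuclideanSpace.single j (1 : ℝ))) h2.fderiv
  convert h using 10 with i _ j _ k _ l _
  simp only [hder]
  rw [← Complex.ofReal_re (∫ z, _), ← integral_complex_ofReal]
  congr 2
  ext z
  simp [mul_comm]

theorem sum_integral_fderiv_lipschitz_nonneg (C : Tensor4 d)
    (hC : ∀ x y, 0 ≤ x ⬝ᵥ (acousticTensor C y *ᵥ x))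
    (u : Fin d → EuclideanSpace ℝ (Fin d) → ℝ) (K : ℝ≥0) (hu : ∀ i, LipschitzWith K (u i))
    (huc : ∀ i, HasCompactSupport (u i)) :
    0 ≤ ∑ i, ∑ j, ∑ k, ∑ l, C i j k l *
      ∫ z, fderiv ℝ (u i) z (EuclideanSpace.single j 1) *
        fderiv ℝ (u k) z (EuclideanSpace.single l 1) := by
  choose w R hw hsupp hbd hlim using fun i =>
    exists_smooth_approx (μ := (volume : Measure (EuclideanSpace ℝ (Fin d)))) (hu i) (huc i)
  have hwc : ∀ i n, HasCompactSupport (w i n) := fun i n =>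
    HasCompactSupport.of_support_subset_isCompact (isCompact_closedBall 0 (R i)) (hsupp i n)
  have hzero : ∀ i n z v, z ∉ closedBall 0 (R i) → fderiv ℝ (w i n) z v = 0 := by
    intro i n z v hz
    have : fderiv ℝ (w i n) z = 0 := by
      by_contra hne
      exact hz (closure_minimal (hsupp i n) isClosed_closedBall (support_fderiv_subset ℝ hne))
    rw [this]; rfl
  refine ge_of_tendsto' (x := atTop) (f := fun n => ∑ i, ∑ j, ∑ k, ∑ l, C i j k l *
      ∫ z, fderiv ℝ (w i n) z (EuclideanSpace.single j 1) *
        fderiv ℝ (w k n) z (EuclideanSpace.single l 1)) ?_ fun n =>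
    sum_integral_fderiv_smooth_nonneg C hC (fun i => w i n) (fun i => hw i n) (fun i => hwc i n)
  refine tendsto_finsetSum _ fun i _ => tendsto_finsetSum _ fun j _ =>
    tendsto_finsetSum _ fun k _ => tendsto_finsetSum _ fun l _ => Tendsto.const_mul _ ?_
  have hcont : ∀ i n v, Continuous fun z => fderiv ℝ (w i n) z v := fun i n v =>
    ((hw i n).continuous_fderiv (by simp)).clm_apply continuous_const
  refine tendsto_integral_of_dominated_convergence
    ((closedBall 0 (R i)).indicator fun _ => (K * ‖EuclideanSpace.single j (1 : ℝ)‖) *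
      (K * ‖EuclideanSpace.single l (1 : ℝ)‖)) (fun n =>
      ((hcont i n _).mul (hcont k n _)).aestronglyMeasurable) ?_ (fun n =>
      Eventually.of_forall fun z => ?_) ?_
  · exact (integrable_indicator_iff measurableSet_closedBall).2
      (integrableOn_const (isCompact_closedBall _ _).measure_lt_top.ne)
  · by_cases hz : z ∈ closedBall 0 (R i)
    · rw [Set.indicator_of_mem hz, norm_mul]
      exact mul_le_mul (hbd i n z _) (hbd k n z _) (norm_nonneg _) (by positivity)
    · rw [Set.indicator_of_notMem hz, hzero i n z _ hz]
      simp
  · filter_upwards [hlim i (EuclideanSpace.single j 1), hlim k (EuclideanSpace.single l 1)]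
      with z h1 h2
    exact h1.mul h2

theorem isCompact_unitCube (d : ℕ) : IsCompact (unitCube d) := by
  have : unitCube d = (EuclideanSpace.equiv (Fin d) ℝ).toHomeomorph ⁻¹'
      (Set.univ.pi fun _ : Fin d => Set.Icc (0 : ℝ) 1) := by
    ext x; simp only [unitCube, Set.mem_preimage, Set.mem_pi, Set.mem_univ, true_imp_iff]; rfl
  rw [this, Homeomorph.isCompact_preimage]
  exact isCompact_univ_pi fun _ => isCompact_Icc

theorem volume_unitCube (d : ℕ) : volume (unitCube d) = 1 := by
  have : unitCube d = (WithLp.ofLp : EuclideanSpace ℝ (Fin d) → _) ⁻¹'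
      (Set.univ.pi fun _ : Fin d => Set.Icc (0 : ℝ) 1) := by
    ext x; simp only [unitCube, Set.mem_preimage, Set.mem_pi, Set.mem_univ, true_imp_iff]; rfl
  rw [this, (PiLp.volume_preserving_ofLp (Fin d)).measure_preimage
    (MeasurableSet.univ_pi fun _ => measurableSet_Icc).nullMeasurableSet, volume_pi_pi]
  simp

section
variable {α : Type*} [MeasurableSpace α] {μ : Measure α} [IsFiniteMeasure μ] {a b : α → ℝ}

theorem integrable_mul_add_mul_add (c p q : ℝ) (ha : Integrable a μ) (hb : Integrable b μ)
    (hab : Integrable (fun z => a z * b z) μ) :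
    Integrable (fun z => c * (p + a z) * (q + b z)) μ := by
  have e : (fun z => c * (p + a z) * (q + b z)) = fun z =>
      c * p * q + (c * p * b z + (c * q * a z + c * (a z * b z))) := by ext z; ring
  rw [e]
  exact (integrable_const _).add
    ((hb.const_mul _).add ((ha.const_mul _).add (hab.const_mul _)))

theorem integral_mul_add_mul_add (c p q : ℝ) (ha : Integrable a μ) (hb : Integrable b μ)
    (hab : Integrable (fun z => a z * b z) μ) :
    ∫ z, c * (p + a z) * (q + b z) ∂μ = c * p * q * μ.real Set.univ + (c * p * ∫ z, b z ∂μ) +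
      (c * q * ∫ z, a z ∂μ) + c * ∫ z, a z * b z ∂μ := by
  have e : (fun z => c * (p + a z) * (q + b z)) = fun z =>
      c * p * q + (c * p * b z + (c * q * a z + c * (a z * b z))) := by ext z; ring
  have h3 := ha.const_mul (c * q)
  have h4 := hab.const_mul c
  have h34 : Integrable (fun z => c * q * a z + c * (a z * b z)) μ := h3.add h4
  have h2 := hb.const_mul (c * p)
  have h234 : Integrable (fun z => c * p * b z + (c * q * a z + c * (a z * b z))) μ := h2.add h34
  rw [e, integral_add (integrable_const _) h234, integral_add h2 h34, integral_add h3 h4,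
    integral_const, integral_const_mul, integral_const_mul, integral_const_mul, smul_eq_mul]
  ring

end

/-- A quadratic form that is nonnegative on rank-one matrices is quasiconvex. -/
theorem isQuasiconvex_tensorForm (C : Tensor4 d)
    (hC : ∀ x y, 0 ≤ x ⬝ᵥ (acousticTensor C y *ᵥ x)) : IsQuasiconvex (tensorForm C) := by
  rintro ξ φ ⟨⟨K, hK⟩, hφ⟩
  let u : Fin d → EuclideanSpace ℝ (Fin d) → ℝ := fun i x => φ x i
  have hproj : ∀ i, LipschitzWith 1 (fun x : EuclideanSpace ℝ (Fin d) => x i) := fun i =>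
    LipschitzWith.of_dist_le_mul fun x y => by
      simpa [dist_eq_norm] using PiLp.norm_apply_le (x - y) i
  have hu : ∀ i, LipschitzWith K (u i) := fun i => by
    have h := (hproj i).comp hK
    rwa [one_mul] at h
  have hsub : ∀ i, Function.support (u i) ⊆ unitCube d := by
    intro i x hx j
    by_contra hj
    refine hx ?_
    have := hφ x fun h => hj ⟨(h j).1.le, (h j).2.le⟩
    simp [u, this]
  have huc : ∀ i, HasCompactSupport (u i) := fun i =>
    HasCompactSupport.of_support_subset_isCompact (isCompact_unitCube d) (hsub i)
  let a : Fin d → Fin d → EuclideanSpace ℝ (Fin d) → ℝ := fun i j z =>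
    fderiv ℝ (u i) z (EuclideanSpace.single j 1)
  have ha0 : ∀ i j z, z ∉ unitCube d → a i j z = 0 := by
    intro i j z hz
    have : fderiv ℝ (u i) z = 0 := by
      by_contra hne
      exact hz (closure_minimal (hsub i) (isCompact_unitCube d).isClosed
        (support_fderiv_subset ℝ hne))
    simp [a, this]
  have hameas : ∀ i j, Measurable (a i j) := fun i j => measurable_fderiv_apply_const ℝ (u i) _
  have habd : ∀ i j z, ‖a i j z‖ ≤ K := by
    intro i j z
    refine ((fderiv ℝ (u i) z).le_opNorm _).trans ?_
    simpa using norm_fderiv_le_of_lipschitz ℝ (hu i)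
  have hfin : volume (unitCube d) ≠ ⊤ := (isCompact_unitCube d).measure_lt_top.ne
  have hmu : IsFiniteMeasure (volume.restrict (unitCube d)) :=
    isFiniteMeasure_restrict.2 hfin
  have hai : ∀ i j, Integrable (a i j) (volume.restrict (unitCube d)) := fun i j =>
    Integrable.of_bound (hameas i j).aestronglyMeasurable K (Eventually.of_forall (habd i j))
  have haai : ∀ i j k l, Integrable (fun z => a i j z * a k l z)
      (volume.restrict (unitCube d)) := fun i j k l =>
    (hai i j).mul_bdd (c := K) (hameas k l).aestronglyMeasurable (Eventually.of_forall (habd k l))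
  have hgrad : ∀ᵐ z, ∀ i j, gradientMatrix φ z i j = a i j z := by
    filter_upwards [hK.ae_differentiableAt (μ := volume)] with z hz i j
    have h1 := ((EuclideanSpace.proj (𝕜 := ℝ) i).hasFDerivAt (x := φ z)).comp z hz.hasFDerivAt
    have h2 : fderiv ℝ (u i) z = _ := h1.fderiv
    simp [a, h2, gradientMatrix]
  have hint1 : ∀ i j, ∫ z in unitCube d, a i j z = 0 := by
    intro i j
    rw [setIntegral_eq_integral_of_forall_compl_eq_zero (ha0 i j)]
    exact integral_fderiv_lipschitz_eq_zero (hu i) (huc i) _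
  have hint2 : ∀ i j k l, ∫ z in unitCube d, a i j z * a k l z = ∫ z, a i j z * a k l z :=
    fun i j k l => setIntegral_eq_integral_of_forall_compl_eq_zero fun z hz => by
      rw [ha0 i j z hz, zero_mul]
  have hexp : ∀ i j k l, (∫ z in unitCube d,
      C i j k l * (ξ i j + a i j z) * (ξ k l + a k l z)) =
      C i j k l * ξ i j * ξ k l + C i j k l * ∫ z, a i j z * a k l z := by
    intro i j k l
    rw [integral_mul_add_mul_add _ _ _ (hai i j) (hai k l) (haai i j k l), hint1, hint1, hint2]
    simp [Measure.real, volume_unitCube]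
  have hmain : ∫ z in unitCube d, tensorForm C (ξ + gradientMatrix φ z) =
      tensorForm C ξ + ∑ i, ∑ j, ∑ k, ∑ l, C i j k l * ∫ z, a i j z * a k l z := by
    calc ∫ z in unitCube d, tensorForm C (ξ + gradientMatrix φ z)
        = ∫ z in unitCube d, ∑ i, ∑ j, ∑ k, ∑ l,
            C i j k l * (ξ i j + a i j z) * (ξ k l + a k l z) := by
          refine integral_congr_ae (ae_restrict_of_ae ?_)
          filter_upwards [hgrad] with z hz
          simp only [tensorForm, Matrix.add_apply, hz]
      _ = _ := by
          rw [integral_sum₄ (fun i j k l z => C i j k l * (ξ i j + a i j z) * (ξ k l + a k l z))]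
          · simp only [hexp, tensorForm, Finset.sum_add_distrib]
          · intro i j k l
            exact integrable_mul_add_mul_add _ _ _ (hai i j) (hai k l) (haai i j k l)
  rw [hmain]
  exact le_add_of_nonneg_right (sum_integral_fderiv_lipschitz_nonneg C hC u K hu huc)

end Quasiconvexity

/-! ### Quasiconvexity implies rank-one nonnegativity -/

section RankOne
open Filter Topology
open scoped ContDiff

variable {d : ℕ}

/-- A smooth bump function, vanishing off the open unit cube. -/
theorem exists_bump_unitCube (d : ℕ) : ∃ ψ : EuclideanSpace ℝ (Fin d) → ℝ,
    ContDiff ℝ ∞ ψ ∧ HasCompactSupport ψ ∧ (∀ x, (¬ ∀ j, x j ∈ Set.Ioo (0 : ℝ) 1) → ψ x = 0) ∧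
      0 < ∫ x in unitCube d, ψ x ^ 2 := by
  let c : EuclideanSpace ℝ (Fin d) := WithLp.toLp 2 fun _ => 1 / 2
  let b : ContDiffBump c := ⟨1 / 4, 1 / 2, by norm_num, by norm_num⟩
  have hin : ∀ x, b x ≠ 0 → ∀ j, x j ∈ Set.Ioo (0 : ℝ) 1 := by
    intro x hx j
    have h1 : x ∈ Metric.ball c (1 / 2) := by
      have : x ∈ Function.support b := hx
      rwa [b.support_eq] at this
    rw [mem_ball_iff_norm] at h1
    have h2 := (PiLp.norm_apply_le (x - c) j).trans_lt h1
    rw [Real.norm_eq_abs, abs_lt] at h2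
    simp only [PiLp.sub_apply, c] at h2
    constructor <;> linarith [h2.1, h2.2]
  refine ⟨b, b.contDiff, b.hasCompactSupport, fun x hx => ?_, ?_⟩
  · by_contra h
    exact hx (hin x h)
  · rw [setIntegral_eq_integral_of_forall_compl_eq_zero]
    · refine Continuous.integral_pos_of_hasCompactSupport_nonneg_nonzero (x := c)
        (b.continuous.pow 2) ?_ (fun x => sq_nonneg _) ?_
      · exact b.hasCompactSupport.comp_left (g := fun t : ℝ => t ^ 2) (by norm_num)
      · have : b c = 1 := b.one_of_mem_closedBall (by simp [b])
        simp [this]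
    · intro x hx
      have : b x = 0 := by
        by_contra h
        exact hx fun j => ⟨(hin x h j).1.le, (hin x h j).2.le⟩
      simp [this]

theorem gradientMatrix_smul {g : EuclideanSpace ℝ (Fin d) → ℝ} {z : EuclideanSpace ℝ (Fin d)}
    {g' : EuclideanSpace ℝ (Fin d) →L[ℝ] ℝ} (hg : HasFDerivAt g g' z)
    (x : EuclideanSpace ℝ (Fin d)) :
    gradientMatrix (fun z => g z • x) z =
      Matrix.vecMulVec x fun j => g' (EuclideanSpace.single j 1) := by
  ext i j
  have h := (hg.smul_const x).fderiv
  simp [gradientMatrix, h, Matrix.vecMulVec_apply, mul_comm]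

/-- The sum of the values at `x ⊗ p` and `x ⊗ q` is unchanged when the pair `(p, q)` is rotated. -/
theorem tensorForm_vecMulVec_rotate (C : Tensor4 d) (x p q : Fin d → ℝ) (c s : ℝ)
    (h : c ^ 2 + s ^ 2 = 1) :
    tensorForm C (Matrix.vecMulVec x (c • p + s • q)) +
      tensorForm C (Matrix.vecMulVec x (-s • p + c • q)) =
    tensorForm C (Matrix.vecMulVec x p) + tensorForm C (Matrix.vecMulVec x q) := by
  simp only [tensorForm, ← Finset.sum_add_distrib, Matrix.vecMulVec_apply, Pi.add_apply,
    Pi.smul_apply, smul_eq_mul]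
  refine Finset.sum_congr rfl fun i _ => Finset.sum_congr rfl fun j _ =>
    Finset.sum_congr rfl fun k _ => Finset.sum_congr rfl fun l _ => ?_
  linear_combination (C i j k l * x i * x k * (p j * p l + q j * q l)) * h

theorem continuous_tensorForm_vecMulVec (C : Tensor4 d) (x : Fin d → ℝ) {X : Type*}
    [TopologicalSpace X] {p : X → Fin d → ℝ} (hp : ∀ j, Continuous fun z => p z j) :
    Continuous fun z => tensorForm C (Matrix.vecMulVec x (p z)) := by
  simp only [tensorForm, Matrix.vecMulVec_apply]
  fun_prop

theorem tensorForm_smul (C : Tensor4 d) (t : ℝ) (ξ : Matrix (Fin d) (Fin d) ℝ) :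
    tensorForm C (t • ξ) = t ^ 2 * tensorForm C ξ := by
  simp only [tensorForm, Finset.mul_sum, Matrix.smul_apply, smul_eq_mul]
  refine Finset.sum_congr rfl fun i _ => Finset.sum_congr rfl fun j _ =>
    Finset.sum_congr rfl fun k _ => Finset.sum_congr rfl fun l _ => by ring

/-- A quasiconvex quadratic form is nonnegative on rank-one matrices. The test fields are the
products of a bump `ψ`, a fixed vector `x` and `n⁻¹ sin (n y·z)` or `n⁻¹ cos (n y·z)`: adding the
two inequalities removes the oscillation, and only `f(x ⊗ y) ∫ ψ²` survives as `n → ∞`. -/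
theorem IsQuasiconvex.biq_nonneg {C : Tensor4 d} (hC : IsQuasiconvex (tensorForm C))
    (x y : Fin d → ℝ) : 0 ≤ x ⬝ᵥ (acousticTensor C y *ᵥ x) := by
  obtain ⟨ψ, hψ, hψc, hψ0, hψpos⟩ := exists_bump_unitCube d
  rw [← tensorForm_vecMulVec]
  let x' : EuclideanSpace ℝ (Fin d) := WithLp.toLp 2 x
  let L : EuclideanSpace ℝ (Fin d) →L[ℝ] ℝ := innerSL ℝ (WithLp.toLp 2 y)
  let q : EuclideanSpace ℝ (Fin d) → Fin d → ℝ := fun z j =>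
    fderiv ℝ ψ z (EuclideanSpace.single j 1)
  have hL : ∀ j, L (EuclideanSpace.single j 1) = y j := fun j => by
    simp [L, EuclideanSpace.inner_single_right]
  have hqc : ∀ j, Continuous fun z => q z j := fun j =>
    (hψ.continuous_fderiv (by simp)).clm_apply continuous_const
  -- the modulated bump `n⁻¹ ψ(z) θ(n y · z) x` is a test field
  have htest : ∀ (n : ℝ) (θ : ℝ → ℝ), ContDiff ℝ ∞ θ →
      IsTestField fun z => (n⁻¹ * (ψ z * θ (n * L z))) • x' := by
    intro n θ hθ
    have hsm : ContDiff ℝ ∞ fun z => (n⁻¹ * (ψ z * θ (n * L z))) • x' := by fun_prop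
    have hcs : HasCompactSupport fun z => (n⁻¹ * (ψ z * θ (n * L z))) • x' := by
      refine hψc.mono fun z hz => ?_
      intro h0
      exact hz (by simp [h0])
    refine ⟨⟨_, (hsm.lipschitzWith_of_hasCompactSupport hcs (by simp)).choose_spec⟩, fun z hz => ?_⟩
    simp [hψ0 z hz]
  have hgrad : ∀ (n : ℝ), n ≠ 0 → ∀ (θ θ' : ℝ → ℝ), (∀ t, HasDerivAt θ (θ' t) t) → ∀ z,
      gradientMatrix (fun z => (n⁻¹ * (ψ z * θ (n * L z))) • x') z =
        Matrix.vecMulVec x (θ' (n * L z) • (ψ z • y) + θ (n * L z) • (n⁻¹ • q z)) := by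
    intro n hn θ θ' hθ z
    have h1 : HasFDerivAt (fun z => n * L z) (n • (L : EuclideanSpace ℝ (Fin d) →L[ℝ] ℝ)) z :=
      L.hasFDerivAt.const_mul n
    have h2 := (hθ (n * L z)).comp_hasFDerivAt z h1
    have h3 :=
      ((hψ.contDiffAt.differentiableAt (x := z) (by simp)).hasFDerivAt.mul h2).const_mul n⁻¹
    have h4 := gradientMatrix_smul h3 x'
    refine h4.trans ?_
    congr 1
    ext j
    simp [hL, q]
    field_simp
  have hmain : ∀ n : ℕ, 0 ≤ tensorForm C (Matrix.vecMulVec x y) * (∫ z in unitCube d, ψ z ^ 2) +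
      ((n : ℝ) + 1)⁻¹ ^ 2 * ∫ z in unitCube d, tensorForm C (Matrix.vecMulVec x (q z)) := by
    intro n
    have hn : ((n : ℝ) + 1) ≠ 0 := by positivity
    have h1 := hC 0 _ (htest (n + 1) Real.sin Real.contDiff_sin)
    have h2 := hC 0 _ (htest (n + 1) Real.cos Real.contDiff_cos)
    have h0 : tensorForm C 0 = 0 := by simp [tensorForm]
    rw [h0] at h1 h2
    simp only [zero_add, hgrad (n + 1) hn Real.sin Real.cos Real.hasDerivAt_sin] at h1
    simp only [zero_add, hgrad (n + 1) hn Real.cos (fun t => -Real.sin t) Real.hasDerivAt_cos] at h2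
    have h3 := add_nonneg h1 h2
    have hc : ∀ {g : EuclideanSpace ℝ (Fin d) → ℝ}, Continuous g →
      IntegrableOn g (unitCube d) := fun hg =>
        hg.continuousOn.integrableOn_compact (isCompact_unitCube d)
    have hψcont := hψ.continuous
    rw [← integral_add (hc (continuous_tensorForm_vecMulVec C x fun j => ?_))
      (hc (continuous_tensorForm_vecMulVec C x fun j => ?_))] at h3
    · simp only [tensorForm_vecMulVec_rotate C x _ _ _ _ (Real.cos_sq_add_sin_sq _),
        Matrix.vecMulVec_smul, tensorForm_smul] at h3
      rw [integral_add (hc (by fun_prop))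
          (hc ((continuous_tensorForm_vecMulVec C x hqc).const_mul _)),
        integral_mul_const, integral_const_mul] at h3
      linarith
    · have := hqc j
      simp only [Pi.add_apply, Pi.smul_apply]
      fun_prop
    · have := hqc j
      simp only [Pi.add_apply, Pi.smul_apply]
      fun_prop
  have hlim : Tendsto (fun n : ℕ => tensorForm C (Matrix.vecMulVec x y) *
      (∫ z in unitCube d, ψ z ^ 2) + ((n : ℝ) + 1)⁻¹ ^ 2 *
        ∫ z in unitCube d, tensorForm C (Matrix.vecMulVec x (q z))) atTop
      (𝓝 (tensorForm C (Matrix.vecMulVec x y) * (∫ z in unitCube d, ψ z ^ 2))) := by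
    have h := ((tendsto_one_div_add_atTop_nhds_zero_nat (𝕜 := ℝ)).pow 2).mul_const
      (∫ z in unitCube d, tensorForm C (Matrix.vecMulVec x (q z)))
    have h' := h.const_add (tensorForm C (Matrix.vecMulVec x y) * (∫ z in unitCube d, ψ z ^ 2))
    simpa using h'
  exact nonneg_of_mul_nonneg_left (ge_of_tendsto' hlim hmain) hψpos

end RankOne

/-! ### Sums of squares of bilinear forms are polyconvex -/

section Polyconvexity

variable {d : ℕ}

theorem HasUsualSymmetries.acousticTensor_isHermitian {C : Tensor4 d} (hC : HasUsualSymmetries C)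
    (y : Fin d → ℝ) : (acousticTensor C y).IsHermitian := by
  ext i k
  simp only [Matrix.conjTranspose_apply, acousticTensor, Matrix.of_apply, star_trivial]
  exact Finset.sum_congr rfl fun j _ => Finset.sum_congr rfl fun l _ => by rw [(hC k j i l).1]

theorem Matrix.IsHermitian.eq_zero_of_dotProduct {n : Type*} [Fintype n] [DecidableEq n]
    {M : Matrix n n ℝ} (hM : M.IsHermitian) (h : ∀ x, x ⬝ᵥ (M *ᵥ x) = 0) : M = 0 := by
  have hp : M.PosSemidef := Matrix.PosSemidef.of_dotProduct_mulVec_nonneg hM fun x => by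
    simp [h]
  refine Matrix.ext_of_mulVec_single fun i => ?_
  rw [(hp.dotProduct_mulVec_zero_iff _).1 (by rw [star_trivial, h]), Matrix.zero_mulVec]

/-- A tensor with the usual symmetries is determined by its biquadratic form. -/
theorem HasUsualSymmetries.ext_of_biq {C C' : Tensor4 d} (hC : HasUsualSymmetries C)
    (hC' : HasUsualSymmetries C')
    (h : ∀ x y, x ⬝ᵥ (acousticTensor C y *ᵥ x) = x ⬝ᵥ (acousticTensor C' y *ᵥ x)) : C = C' := by
  have h1 : ∀ y, acousticTensor C y = acousticTensor C' y := fun y => by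
    rw [← sub_eq_zero]
    refine ((hC.acousticTensor_isHermitian y).sub (hC'.acousticTensor_isHermitian y)
      ).eq_zero_of_dotProduct fun x => ?_
    rw [Matrix.sub_mulVec, dotProduct_sub, h, sub_self]
  funext i j k l
  have h2 : Matrix.of (fun j l => C i j k l - C' i j k l) = 0 := by
    refine Matrix.IsHermitian.eq_zero_of_dotProduct ?_ fun y => ?_
    · ext j l
      simp [(hC i j k l).2, (hC' i j k l).2]
    · have h3 := congrFun (congrFun (h1 y) i) k
      simp only [acousticTensor, Matrix.of_apply] at h3
      rw [← sub_eq_zero, ← Finset.sum_sub_distrib] at h3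
      rw [← h3]
      simp only [dotProduct, Matrix.mulVec, Matrix.of_apply, Finset.mul_sum,
        ← Finset.sum_sub_distrib]
      exact Finset.sum_congr rfl fun j _ => Finset.sum_congr rfl fun l _ => by ring
  exact sub_eq_zero.1 (congrFun (congrFun h2 j) l)

/-- The tensor with the usual symmetries whose biquadratic form is `(xᵀ B y)²`. -/
noncomputable def squareTensor (B : Matrix (Fin d) (Fin d) ℝ) : Tensor4 d := fun i j k l =>
  (B i j * B k l + B i l * B k j) / 2

theorem hasUsualSymmetries_squareTensor (B : Matrix (Fin d) (Fin d) ℝ) :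
    HasUsualSymmetries (squareTensor B) := fun i j k l => by
  simp only [squareTensor]
  constructor <;> ring

theorem sum₄_swap (F : Fin d → Fin d → Fin d → Fin d → ℝ) :
    ∑ i, ∑ j, ∑ k, ∑ l, F i j k l = ∑ i, ∑ j, ∑ k, ∑ l, F i l k j := by
  refine Finset.sum_congr rfl fun i _ => ?_
  rw [Finset.sum_comm]
  conv_rhs => rw [Finset.sum_comm]
  refine Finset.sum_congr rfl fun k _ => Finset.sum_comm

/-- Modulo minors of order two, `squareTensor B` gives the square of a linear form. -/
theorem tensorForm_squareTensor (B ξ : Matrix (Fin d) (Fin d) ℝ) :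
    tensorForm (squareTensor B) ξ = (∑ i, ∑ j, B i j * ξ i j) ^ 2 -
      ∑ i, ∑ j, ∑ k, ∑ l, B i j * B k l / 2 * (ξ i j * ξ k l - ξ i l * ξ k j) := by
  have h1 : (∑ i, ∑ j, B i j * ξ i j) ^ 2 =
      ∑ i, ∑ j, ∑ k, ∑ l, B i j * B k l * ξ i j * ξ k l := by
    simp only [sq, Finset.sum_mul, Finset.mul_sum]
    exact Finset.sum_congr rfl fun i _ => Finset.sum_congr rfl fun j _ =>
      Finset.sum_congr rfl fun k _ => Finset.sum_congr rfl fun l _ => by ring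
  have h2 : tensorForm (squareTensor B) ξ =
      (∑ i, ∑ j, ∑ k, ∑ l, B i j * B k l * ξ i j * ξ k l / 2) +
        ∑ i, ∑ j, ∑ k, ∑ l, B i l * B k j * ξ i j * ξ k l / 2 := by
    simp only [tensorForm, squareTensor, ← Finset.sum_add_distrib]
    exact Finset.sum_congr rfl fun i _ => Finset.sum_congr rfl fun j _ =>
      Finset.sum_congr rfl fun k _ => Finset.sum_congr rfl fun l _ => by ring
  rw [h2, sum₄_swap fun i j k l => B i l * B k j * ξ i j * ξ k l / 2, h1]
  simp only [← Finset.sum_add_distrib, ← Finset.sum_sub_distrib]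
  exact Finset.sum_congr rfl fun i _ => Finset.sum_congr rfl fun j _ =>
    Finset.sum_congr rfl fun k _ => Finset.sum_congr rfl fun l _ => by ring

theorem biq_squareTensor (B : Matrix (Fin d) (Fin d) ℝ) (x y : Fin d → ℝ) :
    x ⬝ᵥ (acousticTensor (squareTensor B) y *ᵥ x) = (x ⬝ᵥ (B *ᵥ y)) ^ 2 := by
  rw [← tensorForm_vecMulVec, tensorForm_squareTensor]
  have : ∑ i, ∑ j, ∑ k, ∑ l, B i j * B k l / 2 * (Matrix.vecMulVec x y i j *
      Matrix.vecMulVec x y k l - Matrix.vecMulVec x y i l * Matrix.vecMulVec x y k j) = 0 :=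
    Finset.sum_eq_zero fun i _ => Finset.sum_eq_zero fun j _ =>
      Finset.sum_eq_zero fun k _ => Finset.sum_eq_zero fun l _ => by
        simp only [Matrix.vecMulVec_apply]; ring
  rw [this, sub_zero]
  congr 1
  simp only [dotProduct, Matrix.mulVec, Finset.mul_sum, Matrix.vecMulVec_apply]
  exact Finset.sum_congr rfl fun i _ => Finset.sum_congr rfl fun j _ => by ring

theorem exists_linearMap_entry (i j : Fin d) :
    ∃ L : (MinorIndex d → ℝ) →ₗ[ℝ] ℝ, ∀ ξ, L (minors ξ) = ξ i j := by
  have hd : 0 < d := i.pos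
  have hmono : ∀ m : Fin d, StrictMono fun _ : Fin 1 => m := fun m a b hab =>
    absurd (Subsingleton.elim a b) hab.ne
  refine ⟨LinearMap.proj ⟨⟨0, hd⟩, OrderEmbedding.ofStrictMono _ (hmono i),
    OrderEmbedding.ofStrictMono _ (hmono j)⟩, fun ξ => ?_⟩
  exact Matrix.det_fin_one _

theorem strictMono_pair {i k : Fin d} (h : i < k) : StrictMono ![i, k] := by
  intro a b hab
  fin_cases a <;> fin_cases b <;> simp_all

/-- The indices need not be increasing, nor distinct: the expression is then a minor up to sign, or
zero. -/
theorem exists_linearMap_minor_two (i j k l : Fin d) :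
    ∃ L : (MinorIndex d → ℝ) →ₗ[ℝ] ℝ, ∀ ξ, L (minors ξ) = ξ i j * ξ k l - ξ i l * ξ k j := by
  have main : ∀ i j k l : Fin d, i < k → j < l → ∃ L : (MinorIndex d → ℝ) →ₗ[ℝ] ℝ,
      ∀ ξ, L (minors ξ) = ξ i j * ξ k l - ξ i l * ξ k j := by
    intro i j k l hik hjl
    have hd : 1 < d := by have := k.isLt; have : i.val < k.val := hik; omega
    refine ⟨LinearMap.proj ⟨⟨1, hd⟩, OrderEmbedding.ofStrictMono ![i, k] (strictMono_pair hik),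
      OrderEmbedding.ofStrictMono ![j, l] (strictMono_pair hjl)⟩, fun ξ => ?_⟩
    exact Matrix.det_fin_two _
  rcases lt_trichotomy i k with hik | rfl | hik
  · rcases lt_trichotomy j l with hjl | rfl | hjl
    · exact main i j k l hik hjl
    · exact ⟨0, fun ξ => by simp⟩
    · obtain ⟨L, hL⟩ := main i l k j hik hjl
      exact ⟨-L, fun ξ => by rw [LinearMap.neg_apply, hL]; ring⟩
  · exact ⟨0, fun ξ => by simp; ring⟩
  · rcases lt_trichotomy j l with hjl | rfl | hjl
    · obtain ⟨L, hL⟩ := main k j i l hik hjl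
      exact ⟨-L, fun ξ => by rw [LinearMap.neg_apply, hL]; ring⟩
    · exact ⟨0, fun ξ => by simp⟩
    · obtain ⟨L, hL⟩ := main k l i j hik hjl
      exact ⟨L, fun ξ => by rw [hL]; ring⟩

theorem tensorForm_add (C C' : Tensor4 d) (ξ : Matrix (Fin d) (Fin d) ℝ) :
    tensorForm (C + C') ξ = tensorForm C ξ + tensorForm C' ξ := by
  simp only [tensorForm, Pi.add_apply, add_mul, Finset.sum_add_distrib]

theorem tensorForm_sum {m : ℕ} (C : Fin m → Tensor4 d) (ξ : Matrix (Fin d) (Fin d) ℝ) :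
    tensorForm (∑ s, C s) ξ = ∑ s, tensorForm (C s) ξ :=
  map_sum (AddMonoidHom.mk' (fun C => tensorForm C ξ) fun C C' => tensorForm_add C C' ξ) C _

theorem convexOn_univ_finset_sum {E ι : Type*} [AddCommGroup E] [Module ℝ E] (s : Finset ι)
    {g : ι → E → ℝ} (hg : ∀ i, ConvexOn ℝ Set.univ (g i)) :
    ConvexOn ℝ Set.univ fun x => ∑ i ∈ s, g i x := by
  classical
  induction s using Finset.induction_on with
  | empty => simpa using convexOn_const (0 : ℝ) convex_univ
  | insert a s ha ih =>
    simp only [Finset.sum_insert ha]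
    exact (hg a).add ih

/-- A form whose biquadratic form is a sum of squares of bilinear forms is a sum of squares of
linear forms plus a combination of minors of order two. -/
theorem IsSumOfSquaresOfBilinear.isPolyconvex {C : Tensor4 d} (hC : HasUsualSymmetries C)
    (h : IsSumOfSquaresOfBilinear C) : IsPolyconvex (tensorForm C) := by
  obtain ⟨m, B, hB⟩ := h
  have hform : ∀ ξ, tensorForm C ξ = ∑ s, tensorForm (squareTensor (B s)) ξ := by
    have : C = ∑ s, squareTensor (B s) := by
      refine hC.ext_of_biq (fun i j k l => ?_) fun x y => ?_
      · simp only [Finset.sum_apply]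
        exact ⟨Finset.sum_congr rfl fun s _ => (hasUsualSymmetries_squareTensor (B s) i j k l).1,
          Finset.sum_congr rfl fun s _ => (hasUsualSymmetries_squareTensor (B s) i j k l).2⟩
      · rw [hB, ← tensorForm_vecMulVec, tensorForm_sum]
        simp only [tensorForm_vecMulVec, biq_squareTensor]
    intro ξ
    rw [← tensorForm_sum, ← this]
  choose L hL using exists_linearMap_entry (d := d)
  choose L₂ hL₂ using exists_linearMap_minor_two (d := d)
  let P : Fin m → (MinorIndex d → ℝ) →ₗ[ℝ] ℝ := fun s => ∑ i, ∑ j, B s i j • L i j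
  let Q : Fin m → (MinorIndex d → ℝ) →ₗ[ℝ] ℝ := fun s =>
    ∑ i, ∑ j, ∑ k, ∑ l, (B s i j * B s k l / 2) • L₂ i j k l
  refine ⟨fun M => ∑ s, ((P s M) ^ 2 - Q s M), ?_, fun ξ => ?_⟩
  · have hconv : ∀ s, ConvexOn ℝ Set.univ fun M => (P s M) ^ 2 - Q s M := by
      intro s
      have h1 : ConvexOn ℝ Set.univ fun M => (P s M) ^ 2 :=
        (even_two.convexOn_pow (𝕜 := ℝ)).comp_linearMap (P s)
      exact h1.sub ((Q s).concaveOn convex_univ)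
    exact convexOn_univ_finset_sum _ hconv
  · rw [hform]
    refine Finset.sum_congr rfl fun s _ => ?_
    simp only [P, Q, tensorForm_squareTensor, LinearMap.sum_apply, LinearMap.smul_apply, hL, hL₂,
      smul_eq_mul]

end Polyconvexity

/-! ### The extended Choi form -/

section Counterexample

/-- The tensor of the quadratic form
`∑ ξᵢᵢ² + 2 (ξ₁₂² + ξ₂₃² + ξ₃₁²) - ∑_{i < j} (ξᵢᵢ ξⱼⱼ + ξᵢⱼ ξⱼᵢ)` on `3 × 3` matrices, whose
biquadratic form is a Choi form. -/
noncomputable def choiTensor : Tensor4 3 := fun i j k l =>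
  if i = k ∧ j = l then (if i = j then 1 else if j = i + 1 then 2 else 0)
  else if (i = j ∧ k = l) ∨ (i = l ∧ j = k) then -1 / 2 else 0

theorem hasUsualSymmetries_choiTensor : HasUsualSymmetries choiTensor := by
  intro i j k l
  constructor <;> unfold choiTensor <;> grind

theorem tensorForm_choiTensor (ξ : Matrix (Fin 3) (Fin 3) ℝ) :
    tensorForm choiTensor ξ = ξ 0 0 ^ 2 + ξ 1 1 ^ 2 + ξ 2 2 ^ 2 +
      2 * (ξ 0 1 ^ 2 + ξ 1 2 ^ 2 + ξ 2 0 ^ 2) - (ξ 0 0 * ξ 1 1 + ξ 0 1 * ξ 1 0) -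
      (ξ 1 1 * ξ 2 2 + ξ 1 2 * ξ 2 1) - (ξ 2 2 * ξ 0 0 + ξ 2 0 * ξ 0 2) := by
  simp [tensorForm, choiTensor, Fin.sum_univ_three]
  ring

/-- Nonnegativity of the form `∑ Dᵢ xᵢ² - (∑ xᵢ yᵢ)²` for `Dᵢ > 0` and `∑ yᵢ² / Dᵢ ≤ 1`, with
denominators cleared. -/
theorem sq_dotProduct_le_of_pos {D₀ D₁ D₂ y₀ y₁ y₂ : ℝ} (h₀ : 0 < D₀) (h₁ : 0 < D₁) (h₂ : 0 < D₂)
    (h : y₀ ^ 2 * D₁ * D₂ + y₁ ^ 2 * D₀ * D₂ + y₂ ^ 2 * D₀ * D₁ ≤ D₀ * D₁ * D₂) (x₀ x₁ x₂ : ℝ) :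
    (x₀ * y₀ + x₁ * y₁ + x₂ * y₂) ^ 2 ≤ D₀ * x₀ ^ 2 + D₁ * x₁ ^ 2 + D₂ * x₂ ^ 2 := by
  have hS : 0 ≤ D₀ * x₀ ^ 2 + D₁ * x₁ ^ 2 + D₂ * x₂ ^ 2 := by positivity
  have hD : 0 < D₀ * D₁ * D₂ := by positivity
  have h1 : 0 ≤ D₂ * (D₀ * x₀ * y₁ - D₁ * x₁ * y₀) ^ 2 + D₁ * (D₀ * x₀ * y₂ - D₂ * x₂ * y₀) ^ 2 +
      D₀ * (D₁ * x₁ * y₂ - D₂ * x₂ * y₁) ^ 2 := by positivity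
  have h2 := mul_le_mul_of_nonneg_left h hS
  refine le_of_mul_le_mul_left ?_ hD
  nlinarith

theorem biq_choiTensor_nonneg (x y : Fin 3 → ℝ) :
    0 ≤ x ⬝ᵥ (acousticTensor choiTensor y *ᵥ x) := by
  rw [← tensorForm_vecMulVec, tensorForm_choiTensor]
  simp only [Matrix.vecMulVec_apply]
  generalize x 0 = a; generalize x 1 = b; generalize x 2 = c
  generalize y 0 = p; generalize y 1 = q; generalize y 2 = r
  -- `sq_dotProduct_le_of_pos` applies unless a coefficient vanishes, which forces two of `p, q, r`
  -- to be zero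
  have key : (a * p + b * q + c * r) ^ 2 ≤ 2 * (p ^ 2 + q ^ 2) * a ^ 2 +
      2 * (q ^ 2 + r ^ 2) * b ^ 2 + 2 * (r ^ 2 + p ^ 2) * c ^ 2 := by
    by_cases h0 : p ^ 2 + q ^ 2 = 0
    · have hp : p = 0 := by nlinarith [sq_nonneg p, sq_nonneg q]
      have hq : q = 0 := by nlinarith [sq_nonneg p, sq_nonneg q]
      subst hp hq
      nlinarith [sq_nonneg (r * b), sq_nonneg (r * c)]
    by_cases h1 : q ^ 2 + r ^ 2 = 0
    · have hp : q = 0 := by nlinarith [sq_nonneg q, sq_nonneg r]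
      have hq : r = 0 := by nlinarith [sq_nonneg q, sq_nonneg r]
      subst hp hq
      nlinarith [sq_nonneg (p * a), sq_nonneg (p * c)]
    by_cases h2 : r ^ 2 + p ^ 2 = 0
    · have hp : r = 0 := by nlinarith [sq_nonneg r, sq_nonneg p]
      have hq : p = 0 := by nlinarith [sq_nonneg r, sq_nonneg p]
      subst hp hq
      nlinarith [sq_nonneg (q * a), sq_nonneg (q * b)]
    have h0' : 0 < p ^ 2 + q ^ 2 := lt_of_le_of_ne (by positivity) (Ne.symm h0)
    have h1' : 0 < q ^ 2 + r ^ 2 := lt_of_le_of_ne (by positivity) (Ne.symm h1)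
    have h2' : 0 < r ^ 2 + p ^ 2 := lt_of_le_of_ne (by positivity) (Ne.symm h2)
    refine sq_dotProduct_le_of_pos (by positivity) (by positivity) (by positivity) ?_ a b c
    have : 0 ≤ 4 * (p * q * r) ^ 2 + 4 * (p ^ 2 * q) ^ 2 + 4 * (q ^ 2 * r) ^ 2 +
      4 * (r ^ 2 * p) ^ 2 := by positivity
    nlinarith [sq_nonneg (p * q * r), sq_nonneg (p ^ 2 * q), sq_nonneg (q ^ 2 * r),
      sq_nonneg (r ^ 2 * p), sq_nonneg (p ^ 2 * r), sq_nonneg (q ^ 2 * p), sq_nonneg (r ^ 2 * q)]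
  nlinarith

variable {n : ℕ}

/-- Extension of a tensor on `ℝ³` by zero. -/
noncomputable def padTensor (n : ℕ) (c : Tensor4 3) : Tensor4 (3 + n) := fun i j k l =>
  Fin.addCases (fun a => Fin.addCases (fun b => Fin.addCases (fun p =>
    Fin.addCases (fun q => c a b p q) (fun _ => 0) l) (fun _ => 0) k) (fun _ => 0) j) (fun _ => 0) i

/-- Extension of a `3 × 3` matrix by zero. -/
noncomputable def padMatrix (n : ℕ) (A : Matrix (Fin 3) (Fin 3) ℝ) :
    Matrix (Fin (3 + n)) (Fin (3 + n)) ℝ := fun i j =>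
  Fin.addCases (fun a => Fin.addCases (fun b => A a b) (fun _ => 0) j) (fun _ => 0) i

theorem hasUsualSymmetries_padTensor {c : Tensor4 3} (hc : HasUsualSymmetries c) :
    HasUsualSymmetries (padTensor n c) := by
  intro i j k l
  induction i using Fin.addCases <;> induction j using Fin.addCases <;>
    induction k using Fin.addCases <;> induction l using Fin.addCases <;>
    simp only [padTensor, Fin.addCases_left, Fin.addCases_right, and_self]
  exact hc _ _ _ _

theorem tensorForm_padTensor (c : Tensor4 3) (ξ : Matrix (Fin (3 + n)) (Fin (3 + n)) ℝ) :
    tensorForm (padTensor n c) ξ = tensorForm c (ξ.submatrix (Fin.castAdd n) (Fin.castAdd n)) := by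
  simp only [tensorForm, padTensor, Fin.sum_univ_add, Fin.addCases_left,
    Fin.addCases_right, zero_mul, Finset.sum_const_zero, add_zero, Matrix.submatrix_apply]

theorem biq_padTensor (c : Tensor4 3) (x y : Fin (3 + n) → ℝ) :
    x ⬝ᵥ (acousticTensor (padTensor n c) y *ᵥ x) = (x ∘ Fin.castAdd n) ⬝ᵥ
      (acousticTensor c (y ∘ Fin.castAdd n) *ᵥ (x ∘ Fin.castAdd n)) := by
  rw [← tensorForm_vecMulVec, ← tensorForm_vecMulVec, tensorForm_padTensor]
  rfl

theorem det_acousticTensor_padTensor (c : Tensor4 3) (y : Fin (3 + (n + 1)) → ℝ) :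
    (acousticTensor (padTensor (n + 1) c) y).det = 0 := by
  refine Matrix.det_eq_zero_of_row_eq_zero (Fin.natAdd 3 0) fun k => ?_
  simp [acousticTensor, padTensor, Fin.addCases_right]

/-- The matrices `A₀, …, A₃` for which the minors of `± Aₐ` average to zero, while the average of
the quadratic form of `choiTensor` is negative. -/
noncomputable def jensenMatrix : Fin 4 → Matrix (Fin 3) (Fin 3) ℝ :=
  ![1, !![0, 1 / 2, 0; 2, 0, 0; 0, 0, 0], !![0, 0, 0; 0, 0, 1 / 2; 0, 2, 0],
    !![0, 0, 2; 0, 0, 0; 1 / 2, 0, 0]]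

theorem sum_minor_two_jensenMatrix (p q u v : Fin 3) :
    ∑ a, (jensenMatrix a p u * jensenMatrix a q v -
      jensenMatrix a p v * jensenMatrix a q u) = 0 := by
  fin_cases p <;> fin_cases q <;> fin_cases u <;> fin_cases v <;>
    simp [jensenMatrix, Fin.sum_univ_four]

theorem sum_tensorForm_jensenMatrix : ∑ a, tensorForm choiTensor (jensenMatrix a) = -3 / 2 := by
  simp [jensenMatrix, Fin.sum_univ_four, tensorForm_choiTensor]
  norm_num

theorem sum_minor_two_padMatrix (p q u v : Fin (3 + n)) :
    ∑ a, (padMatrix n (jensenMatrix a) p u * padMatrix n (jensenMatrix a) q v -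
      padMatrix n (jensenMatrix a) p v * padMatrix n (jensenMatrix a) q u) = 0 := by
  induction p using Fin.addCases <;> induction q using Fin.addCases <;>
    induction u using Fin.addCases <;> induction v using Fin.addCases <;>
    simp only [padMatrix, Fin.addCases_left, Fin.addCases_right, mul_zero, zero_mul, sub_zero,
      Finset.sum_const_zero]
  exact sum_minor_two_jensenMatrix _ _ _ _

theorem det_submatrix_padMatrix_eq_zero (A : Matrix (Fin 3) (Fin 3) ℝ) {r : ℕ}
    (f g : Fin (r + 1) ↪o Fin (3 + n)) (hr : 3 ≤ r) : ((padMatrix n A).submatrix f g).det = 0 := by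
  refine Matrix.det_eq_zero_of_row_eq_zero (Fin.last r) fun j => ?_
  have h1 : r ≤ (f (Fin.last r)).val := by
    have h : ∀ m : ℕ, ∀ hm : m < r + 1, m ≤ (f ⟨m, hm⟩).val := by
      intro m
      induction m with
      | zero => exact fun _ => Nat.zero_le _
      | succ m ih =>
        intro hm
        have hlt : f ⟨m, by omega⟩ < f ⟨m + 1, hm⟩ := f.strictMono (by simp)
        exact (ih (by omega)).trans_lt hlt
    exact h r (Nat.lt_succ_self r)
  rw [Matrix.submatrix_apply]
  have h2 : ∃ m : Fin n, f (Fin.last r) = Fin.natAdd 3 m :=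
    ⟨⟨(f (Fin.last r)).val - 3, by omega⟩, Fin.ext (by simp; omega)⟩
  obtain ⟨m, hm⟩ := h2
  rw [hm, padMatrix, Fin.addCases_right]

/-- Minors of odd order cancel between `A` and `-A`, those of order two cancel over the four
matrices, and those of order at least four vanish. -/
theorem sum_minors_jensen (s : MinorIndex (3 + n)) :
    ∑ a, (minors (padMatrix n (jensenMatrix a)) s +
      minors (-padMatrix n (jensenMatrix a)) s) = 0 := by
  obtain ⟨⟨r, hr⟩, f, g⟩ := s
  have hneg : ∀ X : Matrix (Fin (3 + n)) (Fin (3 + n)) ℝ,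
      minors (-X) ⟨⟨r, hr⟩, f, g⟩ = (-1) ^ (r + 1) * minors X ⟨⟨r, hr⟩, f, g⟩ := by
    intro X
    simp only [minors]
    rw [Matrix.submatrix_neg]
    simp [Matrix.det_neg]
  simp only [hneg]
  rcases Nat.even_or_odd (r + 1) with he | ho
  · rw [he.neg_one_pow]
    simp only [one_mul, Finset.sum_add_distrib, add_self_eq_zero]
    by_cases h1 : r = 1
    · subst h1
      simp only [minors]
      rw [← sum_minor_two_padMatrix (n := n) (f 0) (f 1) (g 0) (g 1)]
      exact Finset.sum_congr rfl fun a _ => Matrix.det_fin_two _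
    · have h3 : 3 ≤ r := by
        rcases he with ⟨m, hm⟩
        omega
      exact Finset.sum_eq_zero fun a _ => det_submatrix_padMatrix_eq_zero _ f g h3
  · simp [ho.neg_one_pow]

theorem tensorForm_neg {d : ℕ} (C : Tensor4 d) (ξ : Matrix (Fin d) (Fin d) ℝ) :
    tensorForm C (-ξ) = tensorForm C ξ := by
  simpa using tensorForm_smul C (-1) ξ

theorem not_isPolyconvex_choi : ¬ IsPolyconvex (tensorForm (padTensor n choiTensor)) := by
  rintro ⟨g, hg, hf⟩
  let X : Fin 4 × Bool → Matrix (Fin (3 + n)) (Fin (3 + n)) ℝ := fun p =>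
    if p.2 then padMatrix n (jensenMatrix p.1) else -padMatrix n (jensenMatrix p.1)
  have hX : ∀ p, tensorForm (padTensor n choiTensor) (X p) =
      tensorForm choiTensor (jensenMatrix p.1) := by
    have h : ∀ A, tensorForm (padTensor n choiTensor) (padMatrix n A) =
        tensorForm choiTensor A := by
      intro A
      rw [tensorForm_padTensor]
      congr 1
      ext i j
      simp [padMatrix]
    rintro ⟨a, _ | _⟩ <;> simp [X, tensorForm_neg, h]
  have h1 := hg.map_sum_le (t := Finset.univ) (w := fun _ : Fin 4 × Bool => (1 / 8 : ℝ))
    (p := fun p => minors (X p)) (fun _ _ => by norm_num) (by simp) (fun _ _ => trivial)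
  have h2 : ∑ p : Fin 4 × Bool, (1 / 8 : ℝ) • minors (X p) = minors (0 : Matrix _ _ ℝ) := by
    rw [← Finset.smul_sum]
    funext s
    have h3 : minors (0 : Matrix (Fin (3 + n)) (Fin (3 + n)) ℝ) s = 0 := by
      simp only [minors, Matrix.submatrix_zero]
      exact Matrix.det_zero
    rw [h3, Pi.smul_apply, Finset.sum_apply, Fintype.sum_prod_type]
    have h4 := sum_minors_jensen (n := n) s
    simp only [Fintype.sum_bool, X] at h4 ⊢
    simp only [if_true, Bool.false_eq_true, if_false]
    rw [h4, smul_zero]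
  rw [h2, ← hf] at h1
  have h5 : ∑ p : Fin 4 × Bool, (1 / 8 : ℝ) • g (minors (X p)) = -3 / 8 := by
    rw [← Finset.smul_sum, Fintype.sum_prod_type]
    simp only [← hf, hX, Fintype.sum_bool, Finset.sum_add_distrib, sum_tensorForm_jensenMatrix]
    norm_num
  have h6 : tensorForm (padTensor n choiTensor) 0 = 0 := by simp [tensorForm]
  rw [h5, h6] at h1
  norm_num at h1

/-- In dimension at least four a Choi form, extended by zero, is quasiconvex with identically
vanishing acoustic determinant, but neither polyconvex nor a sum of squares. -/
theorem exists_counterexample (d : ℕ) (hd : 4 ≤ d) :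
    ∃ C : Tensor4 d, HasUsualSymmetries C ∧ IsQuasiconvex (tensorForm C) ∧
      (∀ y : Fin d → ℝ, (acousticTensor C y).det = 0) ∧
        ¬ IsPolyconvex (tensorForm C) ∧ ¬ IsSumOfSquaresOfBilinear C := by
  obtain ⟨m, rfl⟩ := Nat.exists_eq_add_of_le hd
  obtain ⟨n, hn⟩ : ∃ n, 4 + m = 3 + (n + 1) := ⟨m, by omega⟩
  rw [hn]
  have hs := hasUsualSymmetries_padTensor (n := n + 1) hasUsualSymmetries_choiTensor
  exact ⟨padTensor (n + 1) choiTensor, hs,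
    isQuasiconvex_tensorForm _ fun x y => by
      rw [biq_padTensor]; exact biq_choiTensor_nonneg _ _,
    det_acousticTensor_padTensor _, not_isPolyconvex_choi,
    fun h => not_isPolyconvex_choi (h.isPolyconvex hs)⟩

end Counterexample

/-! ### Splitting off squares -/

section SquareBelow

variable {d : ℕ}

/-- Some nonzero square `(xᵀ B y)²` can be subtracted from the biquadratic form of `C` without
losing nonnegativity. -/
def HasSquareBelow (C : Tensor4 d) : Prop :=
  ∃ B : Matrix (Fin d) (Fin d) ℝ, B ≠ 0 ∧
    ∀ x y, (x ⬝ᵥ (B *ᵥ y)) ^ 2 ≤ x ⬝ᵥ (acousticTensor C y *ᵥ x)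

theorem dotProduct_mulVec_prod (G : Matrix (Fin d × Fin d) (Fin d × Fin d) ℝ) (x y : Fin d → ℝ) :
    (fun p : Fin d × Fin d => x p.1 * y p.2) ⬝ᵥ (G *ᵥ fun p => x p.1 * y p.2) =
      ∑ i, ∑ j, ∑ k, ∑ l, G (i, j) (k, l) * (x i * y j) * (x k * y l) := by
  simp only [dotProduct, Matrix.mulVec, Fintype.sum_prod_type, Finset.mul_sum]
  exact Finset.sum_congr rfl fun i _ => Finset.sum_congr rfl fun j _ =>
    Finset.sum_congr rfl fun k _ => Finset.sum_congr rfl fun l _ => by ring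

/-- The tensor with the usual symmetries whose biquadratic form is the value of the quadratic form
`G` at `x ⊗ y`. -/
noncomputable def gramTensor (G : Matrix (Fin d × Fin d) (Fin d × Fin d) ℝ) : Tensor4 d :=
  fun i j k l => (G (i, j) (k, l) + G (k, j) (i, l) + G (i, l) (k, j) + G (k, l) (i, j)) / 4

theorem hasUsualSymmetries_gramTensor (G : Matrix (Fin d × Fin d) (Fin d × Fin d) ℝ) :
    HasUsualSymmetries (gramTensor G) := fun i j k l => by
  simp only [gramTensor]
  constructor <;> ring

theorem sum₄_swap_first (F : Fin d → Fin d → Fin d → Fin d → ℝ) :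
    ∑ i, ∑ j, ∑ k, ∑ l, F i j k l = ∑ i, ∑ j, ∑ k, ∑ l, F k j i l := by
  have h1 : ∀ F : Fin d → Fin d → Fin d → Fin d → ℝ, ∑ i, ∑ j, ∑ k, ∑ l, F i j k l =
      ∑ i, ∑ k, ∑ j, ∑ l, F i j k l := fun F =>
    Finset.sum_congr rfl fun i _ => Finset.sum_comm
  rw [h1, h1 fun i j k l => F k j i l, Finset.sum_comm]

theorem biq_gramTensor (G : Matrix (Fin d × Fin d) (Fin d × Fin d) ℝ) (x y : Fin d → ℝ) :
    x ⬝ᵥ (acousticTensor (gramTensor G) y *ᵥ x) =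
      (fun p : Fin d × Fin d => x p.1 * y p.2) ⬝ᵥ (G *ᵥ fun p => x p.1 * y p.2) := by
  rw [dotProduct_acousticTensor_mulVec, dotProduct_mulVec_prod]
  have e : ∑ i, ∑ j, ∑ k, ∑ l, gramTensor G i j k l * (x i * y j) * (x k * y l) =
      ((∑ i, ∑ j, ∑ k, ∑ l, G (i, j) (k, l) * (x i * y j) * (x k * y l)) +
        (∑ i, ∑ j, ∑ k, ∑ l, G (k, j) (i, l) * (x k * y j) * (x i * y l)) +
        (∑ i, ∑ j, ∑ k, ∑ l, G (i, l) (k, j) * (x i * y l) * (x k * y j)) +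
        (∑ i, ∑ j, ∑ k, ∑ l, G (k, l) (i, j) * (x k * y l) * (x i * y j))) / 4 := by
    simp only [gramTensor, ← Finset.sum_add_distrib, Finset.sum_div]
    exact Finset.sum_congr rfl fun i _ => Finset.sum_congr rfl fun j _ =>
      Finset.sum_congr rfl fun k _ => Finset.sum_congr rfl fun l _ => by ring
  rw [e, ← sum₄_swap_first fun i j k l => G (i, j) (k, l) * (x i * y j) * (x k * y l),
    ← sum₄_swap fun i j k l => G (i, j) (k, l) * (x i * y j) * (x k * y l),
    sum₄_swap fun i j k l => G (k, l) (i, j) * (x k * y l) * (x i * y j),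
    ← sum₄_swap_first fun i j k l => G (i, j) (k, l) * (x i * y j) * (x k * y l)]
  ring

theorem isSumOfSquaresOfBilinear_gramTensor {G : Matrix (Fin d × Fin d) (Fin d × Fin d) ℝ}
    (hG : G.PosSemidef) : IsSumOfSquaresOfBilinear (gramTensor G) := by
  obtain ⟨m, v, rfl⟩ := Matrix.posSemidef_iff_eq_sum_vecMulVec.1 hG
  refine ⟨m, fun s => Matrix.of fun i j => v s (i, j), fun x y => ?_⟩
  rw [biq_gramTensor, Matrix.sum_mulVec, dotProduct_sum]
  refine Finset.sum_congr rfl fun s _ => ?_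
  rw [Matrix.vecMulVec_mulVec, star_trivial]
  simp only [dotProduct_smul, MulOpposite.smul_eq_mul_unop, MulOpposite.unop_op]
  rw [dotProduct_comm _ (v s), ← sq]
  congr 1
  simp only [Matrix.mulVec, dotProduct, Fintype.sum_prod_type, Matrix.of_apply, Finset.mul_sum]
  exact Finset.sum_congr rfl fun i _ => Finset.sum_congr rfl fun j _ => by ring

theorem acousticTensor_sub (C C' : Tensor4 d) (y : Fin d → ℝ) :
    acousticTensor (C - C') y = acousticTensor C y - acousticTensor C' y := by
  ext i k
  simp only [acousticTensor, Matrix.of_apply, Matrix.sub_apply, Pi.sub_apply, sub_mul,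
    Finset.sum_sub_distrib]

theorem biq_sub (C C' : Tensor4 d) (x y : Fin d → ℝ) :
    x ⬝ᵥ (acousticTensor (C - C') y *ᵥ x) =
      x ⬝ᵥ (acousticTensor C y *ᵥ x) - x ⬝ᵥ (acousticTensor C' y *ᵥ x) := by
  rw [acousticTensor_sub, Matrix.sub_mulVec, dotProduct_sub]

/-- Subtracting a sum of squares of maximal trace from a nonnegative biquadratic form leaves a
nonnegative form from which no further square can be subtracted. -/
theorem exists_maximal_gramTensor (C : Tensor4 d)
    (hC : ∀ x y, 0 ≤ x ⬝ᵥ (acousticTensor C y *ᵥ x)) :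
    ∃ G : Matrix (Fin d × Fin d) (Fin d × Fin d) ℝ, G.PosSemidef ∧
      (∀ x y, 0 ≤ x ⬝ᵥ (acousticTensor (C - gramTensor G) y *ᵥ x)) ∧
        ¬ HasSquareBelow (C - gramTensor G) := by
  let K : Set (Matrix (Fin d × Fin d) (Fin d × Fin d) ℝ) :=
    {G | (∀ a b, G a b = G b a) ∧ (∀ w, 0 ≤ w ⬝ᵥ (G *ᵥ w)) ∧
      ∀ x y : Fin d → ℝ, (fun p : Fin d × Fin d => x p.1 * y p.2) ⬝ᵥ
        (G *ᵥ fun p => x p.1 * y p.2) ≤ x ⬝ᵥ (acousticTensor C y *ᵥ x)}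
  have hKpos : ∀ G ∈ K, G.PosSemidef := fun G hG =>
    Matrix.PosSemidef.of_dotProduct_mulVec_nonneg (by ext a b; simp [hG.1 a b])
      (by simpa using hG.2.1)
  have hK0 : (0 : Matrix _ _ ℝ) ∈ K :=
    ⟨fun _ _ => rfl, fun w => by simp, fun x y => by simpa using hC x y⟩
  have hclosed : IsClosed K := by
    have hc : ∀ w : Fin d × Fin d → ℝ,
        Continuous fun G : Matrix (Fin d × Fin d) (Fin d × Fin d) ℝ => w ⬝ᵥ (G *ᵥ w) := fun w => by
      fun_prop
    have hK : K = (⋂ a, ⋂ b, {G | G a b = G b a}) ∩ ((⋂ w, {G | 0 ≤ w ⬝ᵥ (G *ᵥ w)}) ∩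
        ⋂ x : Fin d → ℝ, ⋂ y : Fin d → ℝ, {G | (fun p : Fin d × Fin d => x p.1 * y p.2) ⬝ᵥ
          (G *ᵥ fun p => x p.1 * y p.2) ≤ x ⬝ᵥ (acousticTensor C y *ᵥ x)}) := by
      ext G
      simp [K]
    rw [hK]
    refine IsClosed.inter ?_ (IsClosed.inter ?_ ?_)
    · exact isClosed_iInter fun a => isClosed_iInter fun b =>
        isClosed_eq (by fun_prop) (by fun_prop)
    · exact isClosed_iInter fun w => isClosed_le continuous_const (hc w)
    · exact isClosed_iInter fun x => isClosed_iInter fun y => isClosed_le (hc _) continuous_const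
  have hbound : ∃ R : ℝ, ∀ G ∈ K, ∀ a b, G a b ∈ Set.Icc (-R) R := by
    let R : ℝ := ∑ a : Fin d × Fin d,
      (Pi.single a.1 1 : Fin d → ℝ) ⬝ᵥ (acousticTensor C (Pi.single a.2 1) *ᵥ Pi.single a.1 1)
    have hdiag : ∀ G ∈ K, ∀ a, G a a ≤ R := by
      intro G hG a
      have h1 := hG.2.2 (Pi.single a.1 1) (Pi.single a.2 1)
      have h2 : (fun p : Fin d × Fin d => (Pi.single a.1 1 : Fin d → ℝ) p.1 *
          (Pi.single a.2 1 : Fin d → ℝ) p.2) = Pi.single a 1 := by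
        ext ⟨p, q⟩
        obtain ⟨i, j⟩ := a
        simp only [Pi.single_apply, Prod.mk.injEq]
        split_ifs <;> simp_all
      rw [h2] at h1
      rw [Matrix.mulVec_single_one, single_one_dotProduct, Matrix.col_apply] at h1
      refine h1.trans ?_
      exact Finset.single_le_sum (f := fun a : Fin d × Fin d => (Pi.single a.1 1 : Fin d → ℝ) ⬝ᵥ
        (acousticTensor C (Pi.single a.2 1) *ᵥ Pi.single a.1 1)) (fun b _ => hC _ _)
        (Finset.mem_univ a)
    refine ⟨R, fun G hG a b => ?_⟩
    have h1 := hG.2.1 (Pi.single a 1 + Pi.single b 1)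
    have h2 := hG.2.1 (Pi.single a 1 - Pi.single b 1)
    simp only [Matrix.mulVec_add, Matrix.mulVec_sub, add_dotProduct, sub_dotProduct, dotProduct_add,
      dotProduct_sub, Matrix.mulVec_single_one, single_one_dotProduct, Matrix.col_apply] at h1 h2
    have h3 := hdiag G hG a
    have h4 := hdiag G hG b
    have h5 := hG.1 a b
    constructor <;> linarith
  obtain ⟨R, hR⟩ := hbound
  have hcomp : IsCompact K := by
    refine IsCompact.of_isClosed_subset (isCompact_univ_pi fun a => isCompact_univ_pi fun b =>
      isCompact_Icc (a := -R) (b := R)) hclosed fun G hG a _ b _ => hR G hG a b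
  obtain ⟨G, hG, hmax⟩ := hcomp.exists_isMaxOn ⟨0, hK0⟩
    (f := fun G => G.trace) (by
      have : Continuous fun G : Matrix (Fin d × Fin d) (Fin d × Fin d) ℝ => G.trace := by fun_prop
      exact this.continuousOn)
  refine ⟨G, hKpos G hG, fun x y => ?_, ?_⟩
  · rw [biq_sub, biq_gramTensor]
    exact sub_nonneg.2 (hG.2.2 x y)
  · rintro ⟨B, hB0, hB⟩
    let b : Fin d × Fin d → ℝ := fun p => B p.1 p.2
    have hquad : ∀ w, w ⬝ᵥ ((G + Matrix.vecMulVec b b) *ᵥ w) = w ⬝ᵥ (G *ᵥ w) + (b ⬝ᵥ w) ^ 2 := by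
      intro w
      rw [Matrix.add_mulVec, dotProduct_add, Matrix.vecMulVec_mulVec]
      simp only [dotProduct_smul, MulOpposite.smul_eq_mul_unop, MulOpposite.unop_op]
      rw [dotProduct_comm w b, sq]
    have hmem : G + Matrix.vecMulVec b b ∈ K := by
      refine ⟨fun p q => ?_, fun w => ?_, fun x y => ?_⟩
      · simp only [Matrix.add_apply, Matrix.vecMulVec_apply, hG.1 p q]; ring
      · rw [hquad]; exact add_nonneg (hG.2.1 w) (sq_nonneg _)
      · have h1 := hB x y
        rw [biq_sub, biq_gramTensor] at h1
        rw [hquad]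
        have h2 : b ⬝ᵥ (fun p : Fin d × Fin d => x p.1 * y p.2) = x ⬝ᵥ (B *ᵥ y) := by
          simp only [b, Matrix.mulVec, dotProduct, Fintype.sum_prod_type, Finset.mul_sum]
          exact Finset.sum_congr rfl fun i _ => Finset.sum_congr rfl fun j _ => by ring
        rw [h2]
        linarith
    have h1 := hmax hmem
    simp only [Set.mem_ofPred_eq, Matrix.trace_add, Matrix.trace_vecMulVec] at h1
    have h2 : b = 0 := dotProduct_self_eq_zero.1
      (le_antisymm (by linarith) (by simpa using dotProduct_star_self_nonneg b))
    exact hB0 (by ext i j; exact congrFun h2 (i, j))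

theorem acousticTensor_posSemidef {C : Tensor4 d} (hs : HasUsualSymmetries C)
    (hC : ∀ x y, 0 ≤ x ⬝ᵥ (acousticTensor C y *ᵥ x)) (y : Fin d → ℝ) :
    (acousticTensor C y).PosSemidef :=
  Matrix.PosSemidef.of_dotProduct_mulVec_nonneg (hs.acousticTensor_isHermitian y)
    (by simpa using fun x => hC x y)

/-- It suffices to split off one square from every nonzero nonnegative form with vanishing
determinant: the determinant stays zero when squares are subtracted. -/
theorem isSumOfSquaresOfBilinear_of_hasSquareBelow
    (H : ∀ C : Tensor4 d, HasUsualSymmetries C → (∀ x y, 0 ≤ x ⬝ᵥ (acousticTensor C y *ᵥ x)) →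
      (∀ y, (acousticTensor C y).det = 0) → C ≠ 0 → HasSquareBelow C)
    {C : Tensor4 d} (hs : HasUsualSymmetries C) (hC : ∀ x y, 0 ≤ x ⬝ᵥ (acousticTensor C y *ᵥ x))
    (hdet : ∀ y, (acousticTensor C y).det = 0) : IsSumOfSquaresOfBilinear C := by
  obtain ⟨G, hG, hpos, hmax⟩ := exists_maximal_gramTensor C hC
  have hs' : HasUsualSymmetries (C - gramTensor G) := fun i j k l => by
    have h1 := hs i j k l
    have h2 := hasUsualSymmetries_gramTensor G i j k l
    simp only [Pi.sub_apply]
    exact ⟨by rw [h1.1, h2.1], by rw [h1.2, h2.2]⟩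
  have hdet' : ∀ y, (acousticTensor (C - gramTensor G) y).det = 0 := by
    intro y
    obtain ⟨v, hv, hv0⟩ := Matrix.exists_mulVec_eq_zero_iff.2 (hdet y)
    refine Matrix.exists_mulVec_eq_zero_iff.1 ⟨v, hv, ?_⟩
    rw [← (acousticTensor_posSemidef hs' hpos y).dotProduct_mulVec_zero_iff, star_trivial]
    refine le_antisymm ?_ (hpos v y)
    rw [biq_sub, hv0, dotProduct_zero, zero_sub, neg_nonpos, biq_gramTensor]
    simpa using hG.dotProduct_mulVec_nonneg fun p : Fin d × Fin d => v p.1 * y p.2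
  have h0 : C = gramTensor G := by
    by_contra hne
    exact hmax (H _ hs' hpos hdet' (sub_ne_zero.2 hne))
  rw [h0]
  exact isSumOfSquaresOfBilinear_gramTensor hG

end SquareBelow

/-! ### Positive semidefinite matrices -/

section PosSemidefMatrices

variable {n : Type*} [Fintype n]

theorem Matrix.IsHermitian.dotProduct_mulVec_comm {M : Matrix n n ℝ} (hM : M.IsHermitian)
    (x z : n → ℝ) : x ⬝ᵥ (M *ᵥ z) = z ⬝ᵥ (M *ᵥ x) := by
  have h : Mᵀ = M := by ext i j; simpa using hM.apply i j
  rw [Matrix.dotProduct_mulVec, ← Matrix.mulVec_transpose, h, dotProduct_comm]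

theorem Matrix.PosSemidef.sq_dotProduct_mulVec_le {M : Matrix n n ℝ} (hM : M.PosSemidef)
    (x z : n → ℝ) : (x ⬝ᵥ (M *ᵥ z)) ^ 2 ≤ (x ⬝ᵥ (M *ᵥ x)) * (z ⬝ᵥ (M *ᵥ z)) := by
  have h : ∀ t : ℝ, 0 ≤ (z ⬝ᵥ (M *ᵥ z)) * (t * t) + (2 * (x ⬝ᵥ (M *ᵥ z))) * t +
      x ⬝ᵥ (M *ᵥ x) := by
    intro t
    have h1 := hM.dotProduct_mulVec_nonneg (x + t • z)
    simp only [star_trivial, Matrix.mulVec_add, Matrix.mulVec_smul, add_dotProduct, dotProduct_add,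
      smul_dotProduct, dotProduct_smul, smul_eq_mul] at h1
    rw [hM.1.dotProduct_mulVec_comm z x] at h1
    linarith
  have h2 := discrim_le_zero h
  rw [discrim] at h2
  linarith

theorem Matrix.PosSemidef.mulVec_eq_zero {M : Matrix n n ℝ} (hM : M.PosSemidef) {x : n → ℝ}
    (hx : x ⬝ᵥ (M *ᵥ x) = 0) : M *ᵥ x = 0 :=
  (hM.dotProduct_mulVec_zero_iff x).1 (by rwa [star_trivial])

/-- A nonzero positive semidefinite matrix whose principal minors of order two vanish has rank
one. -/
theorem Matrix.PosSemidef.exists_eq_vecMulVec [DecidableEq n] {M : Matrix n n ℝ}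
    (hM : M.PosSemidef) (h : ∀ i j, M i i * M j j = M i j ^ 2) (h0 : M ≠ 0) :
    ∃ u : n → ℝ, u ≠ 0 ∧ M = Matrix.vecMulVec u u := by
  obtain ⟨i, hi⟩ : ∃ i, M i i ≠ 0 := by
    by_contra! hd
    refine h0 (Matrix.ext fun i j => ?_)
    have := h i j
    rw [hd i, zero_mul] at this
    exact pow_eq_zero_iff two_ne_zero |>.1 this.symm
  have hpos : 0 < M i i := lt_of_le_of_ne hM.diag_nonneg (Ne.symm hi)
  have hsym : ∀ j k, M j k = M k j := fun j k => by simpa using (hM.1.apply j k).symm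
  have hker : ∀ j k, M i j * M i k = M i i * M j k := by
    intro j k
    let z : n → ℝ := M i j • Pi.single i 1 - M i i • Pi.single j 1
    have hz : M *ᵥ z = 0 := by
      refine hM.mulVec_eq_zero ?_
      simp only [z, Matrix.mulVec_sub, Matrix.mulVec_smul, sub_dotProduct, dotProduct_sub,
        smul_dotProduct, dotProduct_smul, Matrix.mulVec_single_one, single_one_dotProduct,
        Matrix.col_apply, smul_eq_mul]
      rw [hsym j i]
      linear_combination M i i * h i j
    have hzk := congrFun hz k
    simp only [z, Matrix.mulVec_sub, Matrix.mulVec_smul, Matrix.mulVec_single_one, Pi.sub_apply,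
      Pi.smul_apply, Matrix.col_apply, smul_eq_mul, Pi.zero_apply] at hzk
    rw [hsym i k, hsym j k]
    linarith
  have hs : 0 < √(M i i) := Real.sqrt_pos.2 hpos
  refine ⟨fun j => M i j / √(M i i), fun hu => ?_, ?_⟩
  · have := congrFun hu i
    simp only [Pi.zero_apply, div_eq_zero_iff] at this
    rcases this with h | h
    · exact hi h
    · exact hs.ne' h
  · ext j k
    rw [Matrix.vecMulVec_apply, div_mul_div_comm, hker, Real.mul_self_sqrt hpos.le]
    field_simp

end PosSemidefMatrices

/-! ### Acoustic tensors of rank one -/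

section RankOneValue

variable {d : ℕ}

/-- The polarisation `∑ C_{ijkl} z_j y_l` of the acoustic tensor. -/
def acousticPolar (C : Tensor4 d) (z y : Fin d → ℝ) : Matrix (Fin d) (Fin d) ℝ :=
  Matrix.of fun i k => ∑ j, ∑ l, C i j k l * z j * y l

theorem acousticPolar_isHermitian {C : Tensor4 d} (hs : HasUsualSymmetries C) (z y : Fin d → ℝ) :
    (acousticPolar C z y).IsHermitian := by
  ext i k
  simp only [Matrix.conjTranspose_apply, acousticPolar, Matrix.of_apply, star_trivial]
  exact Finset.sum_congr rfl fun j _ => Finset.sum_congr rfl fun l _ => by rw [(hs k j i l).1]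

theorem acousticTensor_add_smul {C : Tensor4 d} (hs : HasUsualSymmetries C) (z y : Fin d → ℝ)
    (t : ℝ) : acousticTensor C (y + t • z) =
      acousticTensor C y + (2 * t) • acousticPolar C z y + t ^ 2 • acousticTensor C z := by
  ext i k
  have h : ∑ j, ∑ l, C i j k l * y j * z l = ∑ j, ∑ l, C i j k l * z j * y l := by
    rw [Finset.sum_comm]
    exact Finset.sum_congr rfl fun j _ => Finset.sum_congr rfl fun l _ => by
      rw [(hs i l k j).2]; ring
  have e : ∑ j, ∑ l, C i j k l * (y j + t * z j) * (y l + t * z l) =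
      (∑ j, ∑ l, C i j k l * y j * y l) + t * (∑ j, ∑ l, C i j k l * y j * z l) +
        t * (∑ j, ∑ l, C i j k l * z j * y l) + t ^ 2 * ∑ j, ∑ l, C i j k l * z j * z l := by
    simp only [Finset.mul_sum, ← Finset.sum_add_distrib]
    exact Finset.sum_congr rfl fun j _ => Finset.sum_congr rfl fun l _ => by ring
  simp only [acousticTensor, acousticPolar, Matrix.of_apply, Matrix.add_apply, Matrix.smul_apply,
    Pi.add_apply, Pi.smul_apply, smul_eq_mul]
  rw [e, h]
  ring

/-- If `T(z) = u uᵀ` is of rank one, completing the square in the direction `z` produces a bilinear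
form `b` with `b² ≤ xᵀ T(y) x`: the mixed term `xᵀ T(z, y) x` vanishes on `u^⊥`, hence is divisible
by `u · x`, and `b` is the quotient. -/
theorem hasSquareBelow_of_rankOne {C : Tensor4 d} (hs : HasUsualSymmetries C)
    (hC : ∀ x y, 0 ≤ x ⬝ᵥ (acousticTensor C y *ᵥ x)) {z u : Fin d → ℝ} (hu : u ≠ 0)
    (hz : acousticTensor C z = Matrix.vecMulVec u u) : HasSquareBelow C := by
  have huu : 0 < u ⬝ᵥ u := lt_of_le_of_ne (by simpa using dotProduct_star_self_nonneg u)
    fun h => hu (dotProduct_self_eq_zero.1 h.symm)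
  let w : Fin d → ℝ := (u ⬝ᵥ u)⁻¹ • u
  have huw : u ⬝ᵥ w = 1 := by
    simp only [w, dotProduct_smul, smul_eq_mul]
    exact inv_mul_cancel₀ huu.ne'
  let W : Matrix (Fin d) (Fin d) ℝ := Matrix.of fun k l => ∑ i, ∑ j, w i * z j * C i j k l
  have hW : ∀ x y, w ⬝ᵥ (acousticPolar C z y *ᵥ x) = x ⬝ᵥ (W *ᵥ y) := by
    intro x y
    have e1 : w ⬝ᵥ (acousticPolar C z y *ᵥ x) =
        ∑ i, ∑ k, ∑ j, ∑ l, x k * w i * z j * C i j k l * y l := by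
      simp only [dotProduct, Matrix.mulVec, acousticPolar, Matrix.of_apply, Finset.mul_sum,
        Finset.sum_mul]
      exact Finset.sum_congr rfl fun i _ => Finset.sum_congr rfl fun k _ =>
        Finset.sum_congr rfl fun j _ => Finset.sum_congr rfl fun l _ => by ring
    have e2 : x ⬝ᵥ (W *ᵥ y) =
        ∑ k, ∑ l, ∑ i, ∑ j, x k * w i * z j * C i j k l * y l := by
      simp only [dotProduct, Matrix.mulVec, W, Matrix.of_apply, Finset.mul_sum, Finset.sum_mul]
      exact Finset.sum_congr rfl fun i _ => Finset.sum_congr rfl fun k _ =>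
        Finset.sum_congr rfl fun j _ => Finset.sum_congr rfl fun l _ => by ring
    rw [e1, e2, Finset.sum_comm]
    refine Finset.sum_congr rfl fun k _ => ?_
    rw [Finset.sum_congr rfl fun i _ => Finset.sum_comm, Finset.sum_comm]
  have hdisc : ∀ x y, (x ⬝ᵥ (acousticPolar C z y *ᵥ x)) ^ 2 ≤
      (x ⬝ᵥ (acousticTensor C y *ᵥ x)) * (u ⬝ᵥ x) ^ 2 := by
    intro x y
    have h : ∀ t : ℝ, 0 ≤ (u ⬝ᵥ x) ^ 2 * (t * t) +
        (2 * (x ⬝ᵥ (acousticPolar C z y *ᵥ x))) * t + x ⬝ᵥ (acousticTensor C y *ᵥ x) := by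
      intro t
      have h1 := hC x (y + t • z)
      rw [acousticTensor_add_smul hs, hz] at h1
      simp only [Matrix.add_mulVec, Matrix.smul_mulVec, dotProduct_add, dotProduct_smul,
        Matrix.vecMulVec_mulVec, smul_eq_mul, MulOpposite.smul_eq_mul_unop,
        MulOpposite.unop_op] at h1
      rw [dotProduct_comm x u] at h1
      linarith
    have h2 := discrim_le_zero h
    rw [discrim] at h2
    linarith
  let B : Matrix (Fin d) (Fin d) ℝ := (2 : ℝ) • W - Matrix.vecMulVec u (w ᵥ* W)
  have hB : ∀ x y, x ⬝ᵥ (B *ᵥ y) = 2 * (w ⬝ᵥ (acousticPolar C z y *ᵥ x)) -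
      (u ⬝ᵥ x) * (w ⬝ᵥ (acousticPolar C z y *ᵥ w)) := by
    intro x y
    rw [hW, hW]
    simp only [B, Matrix.sub_mulVec, Matrix.smul_mulVec, dotProduct_sub, dotProduct_smul,
      Matrix.vecMulVec_mulVec, smul_eq_mul, MulOpposite.smul_eq_mul_unop, MulOpposite.unop_op]
    rw [← Matrix.dotProduct_mulVec, dotProduct_comm x u]
  have hfac : ∀ x y, x ⬝ᵥ (acousticPolar C z y *ᵥ x) = (u ⬝ᵥ x) * (x ⬝ᵥ (B *ᵥ y)) := by
    intro x y
    have h1 : u ⬝ᵥ (x - (u ⬝ᵥ x) • w) = 0 := by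
      rw [dotProduct_sub, dotProduct_smul, huw, smul_eq_mul, mul_one, sub_self]
    have h2 := hdisc (x - (u ⬝ᵥ x) • w) y
    rw [h1, zero_pow two_ne_zero, mul_zero] at h2
    have h3 := pow_eq_zero_iff two_ne_zero |>.1 (le_antisymm h2 (sq_nonneg _))
    simp only [Matrix.mulVec_sub, Matrix.mulVec_smul, sub_dotProduct, dotProduct_sub,
      smul_dotProduct, dotProduct_smul, smul_eq_mul] at h3
    rw [(acousticPolar_isHermitian hs z y).dotProduct_mulVec_comm x w] at h3
    rw [hB]
    linarith
  have hgen : ∀ x y, u ⬝ᵥ x ≠ 0 → (x ⬝ᵥ (B *ᵥ y)) ^ 2 ≤ x ⬝ᵥ (acousticTensor C y *ᵥ x) := by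
    intro x y hx
    have h1 := hdisc x y
    rw [hfac, mul_pow, mul_comm] at h1
    exact le_of_mul_le_mul_right h1 (by positivity)
  refine ⟨B, fun hB0 => ?_, fun x y => ?_⟩
  · have h1 := hfac w z
    have h2 : acousticPolar C z z = acousticTensor C z := rfl
    rw [hB0, Matrix.zero_mulVec, dotProduct_zero, mul_zero, h2, hz] at h1
    simp only [Matrix.vecMulVec_mulVec, dotProduct_smul, MulOpposite.smul_eq_mul_unop,
      MulOpposite.unop_op] at h1
    rw [dotProduct_comm w u, huw] at h1
    norm_num at h1
  · by_cases hx : u ⬝ᵥ x = 0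
    · -- approximate `x` by `x + t w`, which is not orthogonal to `u`
      have hc : ∀ M : Matrix (Fin d) (Fin d) ℝ, Continuous fun t : ℝ =>
          (x + t • w) ⬝ᵥ (M *ᵥ (x + t • w)) := fun M => by fun_prop
      have hc' : Continuous fun t : ℝ => ((x + t • w) ⬝ᵥ (B *ᵥ y)) ^ 2 := by fun_prop
      have h1 := (hc'.tendsto 0).mono_left (nhdsWithin_le_nhds (s := {0}ᶜ))
      have h2 := ((hc (acousticTensor C y)).tendsto 0).mono_left
        (nhdsWithin_le_nhds (s := {0}ᶜ))
      simp only [zero_smul, add_zero] at h1 h2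
      refine le_of_tendsto_of_tendsto h1 h2 ?_
      filter_upwards [self_mem_nhdsWithin] with t ht
      refine hgen _ _ ?_
      rw [dotProduct_add, hx, dotProduct_smul, huw]
      simpa using ht
    · exact hgen x y hx

end RankOneValue

/-! ### Adjugates of singular symmetric matrices of order three -/

section Adjugate

variable {M : Matrix (Fin 3) (Fin 3) ℝ}

/-- The adjugate of a singular `3 × 3` matrix has rank at most one. -/
theorem adjugate_mul_adjugate_apply (hdet : M.det = 0) (i j k l : Fin 3) :
    M.adjugate i j * M.adjugate k l = M.adjugate i l * M.adjugate k j := by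
  have h : M.adjugate.adjugate = 0 := by
    rw [Matrix.adjugate_adjugate _ (by simp), hdet]
    simp
  rw [Matrix.adjugate_fin_three M.adjugate] at h
  have e := fun a b => congrFun (congrFun h a) b
  have e00 := e 0 0
  have e01 := e 0 1
  have e02 := e 0 2
  have e10 := e 1 0
  have e11 := e 1 1
  have e12 := e 1 2
  have e20 := e 2 0
  have e21 := e 2 1
  have e22 := e 2 2
  generalize M.adjugate = D at *
  simp at e00 e01 e02 e10 e11 e12 e20 e21 e22
  fin_cases i <;> fin_cases k <;> first
    | rfl
    | exact mul_comm _ _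
    | (fin_cases j <;> fin_cases l <;> first | rfl | (simp; linarith))

theorem adjugate_eq_cayley (M : Matrix (Fin 3) (Fin 3) ℝ) :
    M.adjugate = M * M - M.trace • M + M.adjugate.trace • 1 := by
  rw [Matrix.adjugate_fin_three]
  ext i j
  fin_cases i <;> fin_cases j <;>
    simp [Matrix.mul_apply, Fin.sum_univ_three, Matrix.trace, Matrix.diag] <;> ring

theorem Matrix.PosSemidef.adjugate_diag_nonneg (hM : M.PosSemidef) (i : Fin 3) :
    0 ≤ M.adjugate i i := by
  have h : ∀ a b : Fin 3, 0 ≤ M a a * M b b - M a b * M b a := fun a b => by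
    have h := (hM.submatrix ![a, b]).det_nonneg
    rw [Matrix.det_fin_two] at h
    simpa using h
  rw [Matrix.adjugate_fin_three]
  fin_cases i <;> simp
  · linarith [h 1 2]
  · linarith [h 0 2]
  · linarith [h 0 1]

theorem Matrix.PosSemidef.adjugate_trace_nonneg (hM : M.PosSemidef) :
    0 ≤ M.adjugate.trace := Finset.sum_nonneg fun i _ => hM.adjugate_diag_nonneg i

theorem Matrix.IsHermitian.apply_comm (hM : M.IsHermitian) (i j : Fin 3) : M i j = M j i := by
  simpa using (hM.apply i j).symm

theorem adjugate_isHermitian (hM : M.IsHermitian) : M.adjugate.IsHermitian := by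
  have h : Mᵀ = M := by ext i j; exact hM.apply_comm j i
  have h2 := M.adjugate_transpose
  rw [h] at h2
  ext i j
  simpa using congrFun (congrFun h2 i) j

theorem Matrix.PosSemidef.minor_eq_zero (hM : M.PosSemidef) (h0 : M.adjugate.trace = 0)
    (i j : Fin 3) : M i i * M j j = M i j ^ 2 := by
  have h1 : ∀ i, M.adjugate i i = 0 := fun i =>
    (Finset.sum_eq_zero_iff_of_nonneg fun i _ => hM.adjugate_diag_nonneg i).1 h0 i
      (Finset.mem_univ i)
  have e0 := h1 0
  have e1 := h1 1
  have e2 := h1 2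
  rw [Matrix.adjugate_fin_three] at e0 e1 e2
  have s01 := hM.1.apply_comm 0 1
  have s02 := hM.1.apply_comm 0 2
  have s12 := hM.1.apply_comm 1 2
  simp only [Matrix.of_apply, Matrix.cons_val, s01, s02, s12] at e0 e1 e2
  fin_cases i <;> fin_cases j <;> simp [sq, s01, s02, s12] <;> linarith

/-- A singular `3 × 3` matrix whose adjugate has nonzero trace has a one-dimensional kernel. -/
theorem mul_eq_mul_of_mulVec_eq_zero (hdet : M.det = 0)
    (hD : 0 < M.adjugate.trace) {v w : Fin 3 → ℝ} (hv : M *ᵥ v = 0) (hw : M *ᵥ w = 0)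
    (i j : Fin 3) : v i * w j = v j * w i := by
  have hdv : ∀ v, M *ᵥ v = 0 → M.adjugate *ᵥ v = M.adjugate.trace • v := by
    intro v hv
    conv_lhs => rw [adjugate_eq_cayley M]
    rw [Matrix.add_mulVec, Matrix.sub_mulVec, ← Matrix.mulVec_mulVec, hv, Matrix.mulVec_zero,
      Matrix.smul_mulVec, hv, smul_zero, sub_zero, zero_add, Matrix.smul_mulVec, Matrix.one_mulVec]
  have h1 : ∀ i, (M.adjugate *ᵥ v) i = M.adjugate.trace * v i := fun i => by rw [hdv v hv]; rfl
  have h2 : ∀ i, (M.adjugate *ᵥ w) i = M.adjugate.trace * w i := fun i => by rw [hdv w hw]; rfl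
  have h3 : (M.adjugate *ᵥ v) i * (M.adjugate *ᵥ w) j =
      (M.adjugate *ᵥ v) j * (M.adjugate *ᵥ w) i := by
    simp only [Matrix.mulVec, dotProduct, Finset.sum_mul_sum]
    exact Finset.sum_congr rfl fun a _ => Finset.sum_congr rfl fun b _ => by
      have h4 := adjugate_mul_adjugate_apply hdet i a j b
      have h5 := adjugate_mul_adjugate_apply hdet i b j a
      have h6 : M.adjugate i a * M.adjugate j b = M.adjugate j a * M.adjugate i b := by
        rw [h4, mul_comm]
      linear_combination (v a * w b) * h6
  rw [h1, h2, h1, h2] at h3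
  have h4 : M.adjugate.trace * M.adjugate.trace ≠ 0 := by positivity
  refine mul_left_cancel₀ h4 ?_
  linarith

/-- The adjugate of a singular symmetric matrix of rank two annihilates the range, that is, the
orthogonal complement of the kernel. -/
theorem adjugate_mulVec_eq_zero (hM : M.IsHermitian) (hdet : M.det = 0)
    (hD : 0 < M.adjugate.trace) {v z : Fin 3 → ℝ} (hv : M *ᵥ v = 0) (hv0 : v ≠ 0)
    (hz : v ⬝ᵥ z = 0) : M.adjugate *ᵥ z = 0 := by
  obtain ⟨j, hj⟩ := Function.ne_iff.1 hv0
  have hMD : M * M.adjugate = 0 := by rw [Matrix.mul_adjugate, hdet, zero_smul]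
  funext k
  have hcol : M *ᵥ (fun i => M.adjugate i k) = 0 := by
    funext i
    exact congrFun (congrFun hMD i) k
  have h1 : v j * (M.adjugate *ᵥ z) k = M.adjugate j k * (v ⬝ᵥ z) := by
    simp only [Matrix.mulVec, dotProduct, Finset.mul_sum]
    refine Finset.sum_congr rfl fun i _ => ?_
    have h2 := mul_eq_mul_of_mulVec_eq_zero hdet hD hv hcol j i
    have h3 := (adjugate_isHermitian hM).apply_comm k i
    rw [h3]
    linear_combination z i * h2
  rw [hz, mul_zero] at h1
  exact (mul_eq_zero.1 h1).resolve_left hj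

/-- Quantitative form of `z ∈ range M`: then `z zᵀ` is bounded by a multiple of `M`. -/
theorem sq_dotProduct_mul_trace_le (hM : M.PosSemidef) (hD : 0 < M.adjugate.trace)
    {z : Fin 3 → ℝ} (hz : M.adjugate *ᵥ z = 0) (x : Fin 3 → ℝ) :
    (x ⬝ᵥ z) ^ 2 * M.adjugate.trace ≤ (x ⬝ᵥ (M *ᵥ x)) * (M.trace * (z ⬝ᵥ z)) := by
  -- by Cayley-Hamilton `w` is, up to the factor `tr (adj M)`, a preimage of `z`
  let w : Fin 3 → ℝ := M.trace • z - M *ᵥ z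
  have hw : M *ᵥ w = M.adjugate.trace • z := by
    rw [adjugate_eq_cayley M, Matrix.add_mulVec, Matrix.sub_mulVec, ← Matrix.mulVec_mulVec,
      Matrix.smul_mulVec, Matrix.smul_mulVec, Matrix.one_mulVec] at hz
    rw [Matrix.mulVec_sub, Matrix.mulVec_smul]
    have : M.adjugate.trace • z = -(M *ᵥ M *ᵥ z - M.trace • M *ᵥ z) := by
      rw [eq_neg_iff_add_eq_zero, add_comm]; exact hz
    rw [this]
    abel
  have h1 := hM.sq_dotProduct_mulVec_le x w
  have h2 : w ⬝ᵥ z ≤ M.trace * (z ⬝ᵥ z) := by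
    have h3 := hM.dotProduct_mulVec_nonneg z
    simp only [w, sub_dotProduct, smul_dotProduct, smul_eq_mul]
    rw [dotProduct_comm (M *ᵥ z) z]
    rw [star_trivial] at h3
    linarith
  have h4 : 0 ≤ x ⬝ᵥ (M *ᵥ x) := by simpa using hM.dotProduct_mulVec_nonneg x
  rw [hw, dotProduct_smul, dotProduct_smul, smul_eq_mul, smul_eq_mul] at h1
  have h5 := mul_le_mul_of_nonneg_left h2 h4
  refine le_of_mul_le_mul_left ?_ hD
  calc M.adjugate.trace * ((x ⬝ᵥ z) ^ 2 * M.adjugate.trace) = (M.adjugate.trace * x ⬝ᵥ z) ^ 2 := by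
        ring
    _ ≤ _ := h1
    _ = M.adjugate.trace * (x ⬝ᵥ (M *ᵥ x) * w ⬝ᵥ z) := by ring
    _ ≤ _ := mul_le_mul_of_nonneg_left h5 hD.le

end Adjugate

/-! ### Splitting off a square by compactness -/

section RangeCondition

theorem acousticTensor_smul {d : ℕ} (C : Tensor4 d) (t : ℝ) (y : Fin d → ℝ) :
    acousticTensor C (t • y) = t ^ 2 • acousticTensor C y := by
  ext i k
  simp only [acousticTensor, Matrix.of_apply, Matrix.smul_apply, Pi.smul_apply, smul_eq_mul,
    Finset.mul_sum]
  exact Finset.sum_congr rfl fun j _ => Finset.sum_congr rfl fun l _ => by ring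

theorem continuous_acousticTensor {d : ℕ} (C : Tensor4 d) : Continuous (acousticTensor C) := by
  refine continuous_matrix fun i k => ?_
  simp only [acousticTensor, Matrix.of_apply]
  fun_prop

/-- If `T(y)` has rank two for all nonzero `y` in a subspace `W` and `B y` lies in the range of
`T(y)`, then a multiple of the square of `xᵀ B y` lies below `xᵀ T(y) x` on `W`, by compactness. -/
theorem exists_mul_sq_le {C : Tensor4 3} (hs : HasUsualSymmetries C)
    (hC : ∀ x y, 0 ≤ x ⬝ᵥ (acousticTensor C y *ᵥ x)) (W : Submodule ℝ (Fin 3 → ℝ))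
    (hpos : ∀ y ∈ W, y ≠ 0 → 0 < (acousticTensor C y).adjugate.trace)
    (B : Matrix (Fin 3) (Fin 3) ℝ)
    (hB : ∀ y ∈ W, (acousticTensor C y).adjugate *ᵥ (B *ᵥ y) = 0) :
    ∃ ε : ℝ, 0 < ε ∧ ∀ y ∈ W, ∀ x,
      ε * (x ⬝ᵥ (B *ᵥ y)) ^ 2 ≤ x ⬝ᵥ (acousticTensor C y *ᵥ x) := by
  let S : Set (Fin 3 → ℝ) := W ∩ Metric.sphere 0 1
  have hS : IsCompact S := (isCompact_sphere 0 1).inter_left W.closed_of_finiteDimensional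
  have hSne : ∀ y ∈ S, y ≠ 0 := by
    rintro y ⟨_, hy⟩ rfl
    simp at hy
  have hTc := continuous_acousticTensor C
  obtain ⟨N, hN⟩ := hS.exists_bound_of_continuousOn
    (f := fun y => (acousticTensor C y).trace * ((B *ᵥ y) ⬝ᵥ (B *ᵥ y)) /
      (acousticTensor C y).adjugate.trace)
    (ContinuousOn.div (by fun_prop) (hTc.matrix_adjugate.matrix_trace).continuousOn
      fun y hy => (hpos y hy.1 (hSne y hy)).ne')
  have hN1 : (0 : ℝ) < |N| + 1 := by positivity
  have hunit : ∀ y ∈ S, ∀ x, (|N| + 1)⁻¹ * (x ⬝ᵥ (B *ᵥ y)) ^ 2 ≤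
      x ⬝ᵥ (acousticTensor C y *ᵥ x) := by
    intro y hy x
    have hD := hpos y hy.1 (hSne y hy)
    have h1 := sq_dotProduct_mul_trace_le (acousticTensor_posSemidef hs hC y) hD (hB y hy.1) x
    have h2 := (le_abs_self _).trans ((hN y hy).trans (le_abs_self N))
    rw [div_le_iff₀ hD] at h2
    rw [inv_mul_le_iff₀ hN1]
    refine le_of_mul_le_mul_right (h1.trans ?_) hD
    have h3 := mul_le_mul_of_nonneg_left h2 (hC x y)
    have h4 : 0 ≤ (x ⬝ᵥ (acousticTensor C y *ᵥ x)) * (acousticTensor C y).adjugate.trace :=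
      mul_nonneg (hC x y) hD.le
    nlinarith
  refine ⟨(|N| + 1)⁻¹, by positivity, fun y hy x => ?_⟩
  by_cases h0 : y = 0
  · simp only [h0, Matrix.mulVec_zero, dotProduct_zero]
    simpa using hC x 0
  · have hn : ‖y‖ ≠ 0 := norm_ne_zero_iff.2 h0
    have h1 := hunit (‖y‖⁻¹ • y) ⟨W.smul_mem _ hy, by simp [norm_smul, hn]⟩ x
    have h2 : y = ‖y‖ • (‖y‖⁻¹ • y) := by rw [smul_smul, mul_inv_cancel₀ hn, one_smul]
    rw [h2, acousticTensor_smul, Matrix.mulVec_smul, Matrix.smul_mulVec, dotProduct_smul,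
      dotProduct_smul, smul_eq_mul, smul_eq_mul]
    have h3 := mul_le_mul_of_nonneg_left h1 (sq_nonneg ‖y‖)
    linarith

theorem hasSquareBelow_of_mul_sq_le {d : ℕ} {C : Tensor4 d} {B : Matrix (Fin d) (Fin d) ℝ}
    (hB : B ≠ 0) {ε : ℝ} (hε : 0 < ε)
    (h : ∀ x y, ε * (x ⬝ᵥ (B *ᵥ y)) ^ 2 ≤ x ⬝ᵥ (acousticTensor C y *ᵥ x)) : HasSquareBelow C := by
  refine ⟨√ε • B, smul_ne_zero (Real.sqrt_pos.2 hε).ne' hB, fun x y => ?_⟩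
  rw [Matrix.smul_mulVec, dotProduct_smul, smul_eq_mul, mul_pow, Real.sq_sqrt hε.le]
  exact h x y

theorem hasSquareBelow_of_adjugate_mulVec {C : Tensor4 3} (hs : HasUsualSymmetries C)
    (hC : ∀ x y, 0 ≤ x ⬝ᵥ (acousticTensor C y *ᵥ x))
    (hpos : ∀ y, y ≠ 0 → 0 < (acousticTensor C y).adjugate.trace)
    {B : Matrix (Fin 3) (Fin 3) ℝ} (hB0 : B ≠ 0)
    (hB : ∀ y, (acousticTensor C y).adjugate *ᵥ (B *ᵥ y) = 0) : HasSquareBelow C := by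
  obtain ⟨ε, hε, h⟩ := exists_mul_sq_le hs hC ⊤ (fun y _ => hpos y) B (fun y _ => hB y)
  exact hasSquareBelow_of_mul_sq_le hB0 hε fun x y => h y trivial x

end RangeCondition

/-! ### Quadratic forms on the null conic -/

section NullConic

/-- The real part of the value of the quadratic form of `A` at the null vector
`(1 - s², 2s, i (1 + s²))`, as a polynomial in the parameter `s` of the null conic. -/
noncomputable def conicRe (A : Matrix (Fin 3) (Fin 3) ℝ) : Polynomial ℝ :=
  .C (A 0 0) * (1 - .X ^ 2) ^ 2 + .C (A 0 1 + A 1 0) * ((1 - .X ^ 2) * (2 * .X)) +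
    .C (A 1 1) * (2 * .X) ^ 2 - .C (A 2 2) * (1 + .X ^ 2) ^ 2

/-- The imaginary part of the value of the quadratic form of `A` at the null vector
`(1 - s², 2s, i (1 + s²))`, as a polynomial in the parameter `s` of the null conic. -/
noncomputable def conicIm (A : Matrix (Fin 3) (Fin 3) ℝ) : Polynomial ℝ :=
  .C (A 0 2 + A 2 0) * ((1 - .X ^ 2) * (1 + .X ^ 2)) +
    .C (A 1 2 + A 2 1) * (2 * .X * (1 + .X ^ 2))

theorem eval_conicRe (A : Matrix (Fin 3) (Fin 3) ℝ) (s : ℝ) : (conicRe A).eval s =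
    A 0 0 * (1 - s ^ 2) ^ 2 + (A 0 1 + A 1 0) * ((1 - s ^ 2) * (2 * s)) +
    A 1 1 * (2 * s) ^ 2 - A 2 2 * (1 + s ^ 2) ^ 2 := by
  simp [conicRe]

theorem eval_conicIm (A : Matrix (Fin 3) (Fin 3) ℝ) (s : ℝ) : (conicIm A).eval s =
    (A 0 2 + A 2 0) * ((1 - s ^ 2) * (1 + s ^ 2)) +
    (A 1 2 + A 2 1) * (2 * s * (1 + s ^ 2)) := by
  simp [conicIm]

theorem dotProduct_mulVec_vec3 (A : Matrix (Fin 3) (Fin 3) ℝ) (a b c : ℝ) :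
    ![a, b, c] ⬝ᵥ (A *ᵥ ![a, b, c]) = A 0 0 * a ^ 2 + A 1 1 * b ^ 2 + A 2 2 * c ^ 2 +
      (A 0 1 + A 1 0) * (a * b) + (A 0 2 + A 2 0) * (a * c) + (A 1 2 + A 2 1) * (b * c) := by
  simp [Matrix.mulVec, dotProduct, Fin.sum_univ_three]
  ring

/-- If `a - σ i b` with `σ = ± 1` vanishes on the null conic, where `a` and `b` are the quadratic
forms of `A` and `B`, both forms are multiples of the Euclidean form. -/
theorem isScalar_of_conic {A B : Matrix (Fin 3) (Fin 3) ℝ} {σ : ℝ} (hσ : σ ^ 2 = 1)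
    (h1 : ∀ s, (conicRe A).eval s + σ * (conicIm B).eval s = 0)
    (h2 : ∀ s, (conicIm A).eval s - σ * (conicRe B).eval s = 0) (y : Fin 3 → ℝ) :
    y ⬝ᵥ (A *ᵥ y) = A 0 0 * (y ⬝ᵥ y) ∧ y ⬝ᵥ (B *ᵥ y) = B 0 0 * (y ⬝ᵥ y) := by
  -- a polynomial of degree four is determined by five values
  simp only [eval_conicRe, eval_conicIm] at h1 h2
  have a0 := h1 0
  have a1 := h1 1
  have a2 := h1 (-1)
  have a3 := h1 2
  have a4 := h1 (-2)
  have b0 := h2 0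
  have b1 := h2 1
  have b2 := h2 (-1)
  have b3 := h2 2
  have b4 := h2 (-2)
  norm_num at a0 a1 a2 a3 a4 b0 b1 b2 b3 b4
  have hσ0 : σ ≠ 0 := fun h => by rw [h] at hσ; norm_num at hσ
  have e1 : A 1 1 = A 0 0 := by linarith
  have e2 : A 2 2 = A 0 0 := by linarith
  have e3 : A 0 1 + A 1 0 = 0 := by linarith
  have e4 : A 0 2 + A 2 0 = 0 := by linarith
  have e5 : A 1 2 + A 2 1 = 0 := by linarith
  have f1 : B 1 1 = B 0 0 := mul_left_cancel₀ hσ0 (by linarith)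
  have f2 : B 2 2 = B 0 0 := mul_left_cancel₀ hσ0 (by linarith)
  have f3 : B 0 1 + B 1 0 = 0 := mul_left_cancel₀ hσ0 (by linarith)
  have f4 : B 0 2 + B 2 0 = 0 := mul_left_cancel₀ hσ0 (by linarith)
  have f5 : B 1 2 + B 2 1 = 0 := mul_left_cancel₀ hσ0 (by linarith)
  have hy : y = ![y 0, y 1, y 2] := by ext i; fin_cases i <;> rfl
  rw [hy, dotProduct_mulVec_vec3, dotProduct_mulVec_vec3, e1, e2, e3, e4, e5, f1, f2, f3, f4, f5]
  simp only [dotProduct, Fin.sum_univ_three, Matrix.cons_val]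
  constructor <;> ring

/-- If the sum of squares of two real quadratic forms in three variables is divisible by the
Euclidean form, both are multiples of it: on the null conic, which is a rational curve, one of
`a ± i b` vanishes, because `a² + b²` does. -/
theorem isScalar_of_sq_add_sq {A B R : Matrix (Fin 3) (Fin 3) ℝ}
    (h : ∀ y, (y ⬝ᵥ (A *ᵥ y)) ^ 2 + (y ⬝ᵥ (B *ᵥ y)) ^ 2 = (y ⬝ᵥ y) * (y ⬝ᵥ (R *ᵥ y)))
    (y : Fin 3 → ℝ) :
    y ⬝ᵥ (A *ᵥ y) = A 0 0 * (y ⬝ᵥ y) ∧ y ⬝ᵥ (B *ᵥ y) = B 0 0 * (y ⬝ᵥ y) := by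
  have hval : ∀ s t : ℝ, _ := fun s t => h ![1 - s ^ 2, 2 * s, t * (1 + s ^ 2)]
  simp only [dotProduct_mulVec_vec3] at hval
  simp only [dotProduct, Fin.sum_univ_three, Matrix.cons_val] at hval
  -- the identity at `t = i`, obtained from five real values of the quartic polynomial in `t`
  have hre : ∀ s, (conicRe A).eval s ^ 2 - (conicIm A).eval s ^ 2 + (conicRe B).eval s ^ 2 -
      (conicIm B).eval s ^ 2 = 0 := by
    intro s
    have h0 := hval s 0
    have h1 := hval s 1
    have h2 := hval s (-1)
    have h3 := hval s 2
    have h4 := hval s (-2)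
    rw [eval_conicRe, eval_conicIm, eval_conicRe, eval_conicIm]
    linear_combination (1 + 5 / 4 + 1 / 4) * h0 - (2 / 3 + 1 / 6) * (h1 + h2) +
      (1 / 24 + 1 / 24) * (h3 + h4)
  have him : ∀ s, (conicRe A).eval s * (conicIm A).eval s +
      (conicRe B).eval s * (conicIm B).eval s = 0 := by
    intro s
    have h1 := hval s 1
    have h2 := hval s (-1)
    have h3 := hval s 2
    have h4 := hval s (-2)
    rw [eval_conicRe, eval_conicIm, eval_conicRe, eval_conicIm]
    linear_combination (5 / 12 : ℝ) * (h1 - h2) - (1 / 12 : ℝ) * (h3 - h4)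
  -- `F σ` is the squared modulus of `a - σ i b` on the null conic
  let F : ℝ → Polynomial ℝ := fun σ => (conicRe A + .C σ * conicIm B) ^ 2 +
    (conicIm A - .C σ * conicRe B) ^ 2
  have hF : F 1 * F (-1) = 0 := by
    refine Polynomial.funext fun s => ?_
    have h1 := hre s
    have h2 := him s
    simp only [F, Polynomial.eval_mul, Polynomial.eval_add, Polynomial.eval_pow,
      Polynomial.eval_sub, Polynomial.eval_C, Polynomial.eval_zero]
    generalize (conicRe A).eval s = p at *
    generalize (conicIm A).eval s = q at *
    generalize (conicRe B).eval s = r at *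
    generalize (conicIm B).eval s = t at *
    linear_combination (p ^ 2 - q ^ 2 + r ^ 2 - t ^ 2) * h1 + 4 * (p * q + r * t) * h2
  have hz : ∀ σ, σ ^ 2 = 1 → F σ = 0 →
      y ⬝ᵥ (A *ᵥ y) = A 0 0 * (y ⬝ᵥ y) ∧ y ⬝ᵥ (B *ᵥ y) = B 0 0 * (y ⬝ᵥ y) := by
    intro σ hσ hF0
    have hs : ∀ s, (conicRe A).eval s + σ * (conicIm B).eval s = 0 ∧
        (conicIm A).eval s - σ * (conicRe B).eval s = 0 := by
      intro s
      have h1 := congrArg (Polynomial.eval s) hF0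
      simp only [F, Polynomial.eval_mul, Polynomial.eval_add, Polynomial.eval_pow,
        Polynomial.eval_sub, Polynomial.eval_C, Polynomial.eval_zero] at h1
      have h2 := (add_eq_zero_iff_of_nonneg (sq_nonneg _) (sq_nonneg _)).1 h1
      exact ⟨pow_eq_zero_iff two_ne_zero |>.1 h2.1, pow_eq_zero_iff two_ne_zero |>.1 h2.2⟩
    exact isScalar_of_conic hσ (fun s => (hs s).1) (fun s => (hs s).2) y
  rcases mul_eq_zero.1 hF with h1 | h1
  · exact hz 1 (by norm_num) h1
  · exact hz (-1) (by norm_num) h1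

open scoped MatrixOrder in
/-- The same for an arbitrary positive definite quadratic form, by a change of variables. -/
theorem exists_eq_mul_of_sq_add_sq {Q A B R : Matrix (Fin 3) (Fin 3) ℝ} (hQ : Q.PosDef)
    (h : ∀ y, (y ⬝ᵥ (A *ᵥ y)) ^ 2 + (y ⬝ᵥ (B *ᵥ y)) ^ 2 =
      (y ⬝ᵥ (Q *ᵥ y)) * (y ⬝ᵥ (R *ᵥ y))) :
    ∃ α β : ℝ, ∀ y, y ⬝ᵥ (A *ᵥ y) = α * (y ⬝ᵥ (Q *ᵥ y)) ∧
      y ⬝ᵥ (B *ᵥ y) = β * (y ⬝ᵥ (Q *ᵥ y)) := by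
  obtain ⟨L, hL, hQL⟩ : ∃ L : Matrix (Fin 3) (Fin 3) ℝ, IsUnit L ∧ Q = Lᵀ * L := by
    obtain ⟨L, hL⟩ := CStarAlgebra.nonneg_iff_eq_star_mul_self.mp hQ.posSemidef.nonneg
    refine ⟨L, (Matrix.isUnit_iff_isUnit_det L).2 ?_, by rw [hL]; ext i j; simp [Matrix.mul_apply]⟩
    rw [isUnit_iff_ne_zero]
    intro h0
    have := hQ.det_pos
    rw [hL, Matrix.det_mul, h0, mul_zero] at this
    exact lt_irrefl _ this
  have hdet : IsUnit L.det := (Matrix.isUnit_iff_isUnit_det L).1 hL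
  have hconj : ∀ (M : Matrix (Fin 3) (Fin 3) ℝ) (y : Fin 3 → ℝ),
      y ⬝ᵥ ((L⁻¹ᵀ * M * L⁻¹) *ᵥ y) = (L⁻¹ *ᵥ y) ⬝ᵥ (M *ᵥ (L⁻¹ *ᵥ y)) := by
    intro M y
    rw [← Matrix.mulVec_mulVec, ← Matrix.mulVec_mulVec, Matrix.dotProduct_mulVec,
      Matrix.vecMul_transpose]
  have hone : ∀ y, (L⁻¹ *ᵥ y) ⬝ᵥ (Q *ᵥ (L⁻¹ *ᵥ y)) = y ⬝ᵥ y := by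
    intro y
    rw [hQL, ← Matrix.mulVec_mulVec, Matrix.mulVec_mulVec y L, Matrix.mul_nonsing_inv _ hdet,
      Matrix.one_mulVec, Matrix.mulVec_transpose, dotProduct_comm, ← Matrix.dotProduct_mulVec,
      Matrix.mulVec_mulVec, Matrix.mul_nonsing_inv _ hdet, Matrix.one_mulVec]
  have h1 := isScalar_of_sq_add_sq (A := L⁻¹ᵀ * A * L⁻¹) (B := L⁻¹ᵀ * B * L⁻¹)
    (R := L⁻¹ᵀ * R * L⁻¹) fun y => by rw [hconj, hconj, hconj, h, hone]
  refine ⟨(L⁻¹ᵀ * A * L⁻¹) 0 0, (L⁻¹ᵀ * B * L⁻¹) 0 0, fun y => ?_⟩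
  have h2 := h1 (L *ᵥ y)
  have h3 : L⁻¹ *ᵥ (L *ᵥ y) = y := by
    rw [Matrix.mulVec_mulVec, Matrix.nonsing_inv_mul _ hdet, Matrix.one_mulVec]
  rw [hconj, hconj, h3, ← hone, h3] at h2
  exact h2

end NullConic

/-! ### The kernel of the acoustic tensor as a vector of forms -/

section RankOneFactorisation

/-- Over a unique factorisation domain a symmetric matrix of rank one is `c v vᵀ`, where `v` is the
primitive part of one of its columns. -/
theorem exists_eq_mul_mul_of_rankOne {R ι : Type*} [CommRing R] [IsDomain R]
    [UniqueFactorizationMonoid R] [Fintype ι] (D : Matrix ι ι R) (hsym : ∀ i j, D i j = D j i)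
    (hrank : ∀ i j k l, D i j * D k l = D i l * D k j) {m : ι} (hm : D m m ≠ 0) :
    ∃ (c : R) (v : ι → R), ∀ i j, D i j = c * (v i * v j) := by
  classical
  let _ : StrongNormalizationMonoid R := UniqueFactorizationMonoid.strongNormalizationMonoid
  let _ : StrongNormalizedGCDMonoid R := UniqueFactorizationMonoid.toStrongNormalizedGCDMonoid R
  obtain ⟨v, hv, hprim⟩ := Finset.extract_gcd (s := Finset.univ) (fun i => D i m)
    ⟨m, Finset.mem_univ m⟩
  generalize (Finset.univ.gcd fun i => D i m) = h at hv
  replace hv : ∀ i, D i m = h * v i := fun i => hv i (Finset.mem_univ i)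
  have hh : h ≠ 0 := fun h0 => hm (by rw [hv, h0, zero_mul])
  have hvm : v m ≠ 0 := fun h0 => hm (by rw [hv, h0, mul_zero])
  have h1 : ∀ i j, v m * D i j = h * (v i * v j) := by
    intro i j
    refine mul_left_cancel₀ hh ?_
    have h2 := hrank i j m m
    rw [hsym m j, hv i, hv j, hv m] at h2
    linear_combination h2
  have hdvd : ∀ a : R, (∀ j, v m ∣ a * v j) → v m ∣ a := by
    intro a ha
    have h2 : v m ∣ Finset.univ.gcd fun j => a * v j := Finset.dvd_gcd fun j _ => ha j
    have h3 := h2.trans (Finset.gcd_mul_left' Finset.univ v a).dvd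
    rwa [hprim, mul_one] at h3
  obtain ⟨c, hc⟩ := hdvd h fun i => hdvd (h * v i) fun j =>
    ⟨D i j, by rw [h1]; ring⟩
  refine ⟨c, v, fun i j => mul_left_cancel₀ hvm ?_⟩
  rw [h1, hc]
  ring

open MvPolynomial

variable {σ : Type*}

theorem homogeneousComponent_mul_of_totalDegree_le {p q : ℕ} {f g : MvPolynomial σ ℝ}
    (hf : f.totalDegree ≤ p) (hg : g.totalDegree ≤ q) :
    homogeneousComponent (p + q) (f * g) = homogeneousComponent p f * homogeneousComponent q g := by
  have hsum : ∀ {f : MvPolynomial σ ℝ} {p : ℕ}, f.totalDegree ≤ p →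
      f = ∑ i ∈ Finset.range (p + 1), homogeneousComponent i f := by
    intro f p hf
    conv_lhs => rw [← sum_homogeneousComponent f]
    refine Finset.sum_subset (by simpa using hf) fun i _ hi => homogeneousComponent_eq_zero _ _ ?_
    simpa using hi
  conv_lhs => rw [hsum hf, hsum hg, Finset.sum_mul_sum]
  simp only [map_sum]
  have hterm : ∀ i j, homogeneousComponent (p + q)
      (homogeneousComponent i f * homogeneousComponent j g) =
      if p + q = i + j then homogeneousComponent i f * homogeneousComponent j g else 0 := fun i j =>
    homogeneousComponent_of_mem ((homogeneousComponent_isHomogeneous i f).mul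
      (homogeneousComponent_isHomogeneous j g))
  simp only [hterm]
  rw [Finset.sum_eq_single p, Finset.sum_eq_single q]
  · simp
  · intro j hj hjq
    rw [if_neg]; omega
  · simp
  · intro i hi hip
    refine Finset.sum_eq_zero fun j hj => ?_
    rw [if_neg]
    rw [Finset.mem_range] at hi hj
    omega
  · simp

/-- The factorisation of a symmetric rank-one matrix of quartic forms consists of forms. -/
theorem exists_homogeneous_factorisation {ι : Type*} [Fintype ι]
    (D : Matrix ι ι (MvPolynomial σ ℝ)) (hsym : ∀ i j, D i j = D j i)
    (hrank : ∀ i j k l, D i j * D k l = D i l * D k j) (hhom : ∀ i j, (D i j).IsHomogeneous 4)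
    {m : ι} (hm : D m m ≠ 0) :
    ∃ (e : ℕ) (c : MvPolynomial σ ℝ) (v : ι → MvPolynomial σ ℝ), e ≤ 2 ∧
      c.IsHomogeneous (4 - 2 * e) ∧ (∀ i, (v i).IsHomogeneous e) ∧
        ∀ i j, D i j = c * (v i * v j) := by
  obtain ⟨c, v, hD⟩ := exists_eq_mul_mul_of_rankOne D hsym hrank hm
  have hc : c ≠ 0 := fun h => hm (by rw [hD, h, zero_mul])
  have hdeg : ∀ i, v i ≠ 0 → c.totalDegree + 2 * (v i).totalDegree = 4 := by
    intro i hi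
    have h1 : D i i ≠ 0 := by rw [hD]; exact mul_ne_zero hc (mul_ne_zero hi hi)
    have h2 := (hhom i i).totalDegree h1
    rw [hD, totalDegree_mul_of_isDomain hc (mul_ne_zero hi hi),
      totalDegree_mul_of_isDomain hi hi] at h2
    omega
  have hvm : v m ≠ 0 := fun h => hm (by rw [hD, h]; simp)
  have hdm := hdeg m hvm
  have hle : ∀ i, (v i).totalDegree ≤ (v m).totalDegree := by
    intro i
    by_cases hi : v i = 0
    · simp [hi]
    · have := hdeg i hi; omega
  refine ⟨(v m).totalDegree, homogeneousComponent (4 - 2 * (v m).totalDegree) c,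
    fun i => homogeneousComponent (v m).totalDegree (v i), by omega,
    homogeneousComponent_isHomogeneous _ _, fun i => homogeneousComponent_isHomogeneous _ _,
    fun i j => ?_⟩
  rw [← homogeneousComponent_mul_of_totalDegree_le (hle i) (hle j),
    ← homogeneousComponent_mul_of_totalDegree_le (by omega)
      ((totalDegree_mul _ _).trans (add_le_add (hle i) (hle j))), ← hD,
    show 4 - 2 * (v m).totalDegree + ((v m).totalDegree + (v m).totalDegree) = 4 by omega,
    homogeneousComponent_eq_self (hhom i j)]

theorem eval_of_isHomogeneous_zero {p : MvPolynomial σ ℝ} (hp : p.IsHomogeneous 0) :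
    ∃ a : ℝ, ∀ y, eval y p = a := by
  have h := totalDegree_eq_zero_iff_eq_C.1 ((totalDegree_zero_iff_isHomogeneous _).2 hp)
  exact ⟨coeff 0 p, fun y => by rw [h]; simp⟩

theorem eval_of_isHomogeneous_one {n : ℕ} {p : MvPolynomial (Fin n) ℝ} (hp : p.IsHomogeneous 1) :
    ∃ a : Fin n → ℝ, ∀ y, eval y p = a ⬝ᵥ y := by
  have h : p ∈ Submodule.span ℝ (Set.range X) := by
    rw [← homogeneousSubmodule_one_eq_span_X]
    exact hp
  obtain ⟨a, ha⟩ := Submodule.mem_span_range_iff_exists_fun ℝ |>.1 h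
  refine ⟨a, fun y => ?_⟩
  rw [← ha]
  simp [dotProduct, smul_eval]

theorem eval_of_isHomogeneous_two {n : ℕ} {p : MvPolynomial (Fin n) ℝ} (hp : p.IsHomogeneous 2) :
    ∃ Q : Matrix (Fin n) (Fin n) ℝ, ∀ y, eval y p = y ⬝ᵥ (Q *ᵥ y) := by
  have h : p ∈ homogeneousSubmodule (Fin n) ℝ 1 * homogeneousSubmodule (Fin n) ℝ 1 := by
    rw [← sq, homogeneousSubmodule_one_pow]
    exact hp
  refine Submodule.mul_induction_on h (fun f hf g hg => ?_) fun f g hf hg => ?_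
  · obtain ⟨a, ha⟩ := eval_of_isHomogeneous_one hf
    obtain ⟨b, hb⟩ := eval_of_isHomogeneous_one hg
    refine ⟨Matrix.vecMulVec a b, fun y => ?_⟩
    rw [map_mul, ha, hb, Matrix.vecMulVec_mulVec]
    simp only [dotProduct_smul, MulOpposite.smul_eq_mul_unop, MulOpposite.unop_op]
    rw [dotProduct_comm y a]
  · obtain ⟨P, hP⟩ := hf
    obtain ⟨Q, hQ⟩ := hg
    exact ⟨P + Q, fun y => by rw [map_add, hP, hQ, Matrix.add_mulVec, dotProduct_add]⟩

/-- The vector of the quadratic forms given by a family of matrices. -/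
def quadraticMap (Q : Fin 3 → Matrix (Fin 3) (Fin 3) ℝ) (y : Fin 3 → ℝ) : Fin 3 → ℝ :=
  fun i => y ⬝ᵥ (Q i *ᵥ y)

/-- The acoustic tensor as a matrix of polynomials. -/
noncomputable def acousticPolynomial (C : Tensor4 3) :
    Matrix (Fin 3) (Fin 3) (MvPolynomial (Fin 3) ℝ) :=
  Matrix.of fun i k => ∑ j, ∑ l, MvPolynomial.C (C i j k l) * X j * X l

theorem eval_acousticPolynomial (C : Tensor4 3) (y : Fin 3 → ℝ) :
    (eval y).mapMatrix (acousticPolynomial C) = acousticTensor C y := by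
  ext i k
  simp [acousticPolynomial, acousticTensor]

theorem isHomogeneous_acousticPolynomial (C : Tensor4 3) (i k : Fin 3) :
    (acousticPolynomial C i k).IsHomogeneous 2 := by
  simp only [acousticPolynomial, Matrix.of_apply]
  exact IsHomogeneous.sum _ _ 2 fun j _ => IsHomogeneous.sum _ _ 2 fun l _ =>
    ((isHomogeneous_X ℝ j).C_mul _).mul (isHomogeneous_X ℝ l)

theorem eval_adjugate_acousticPolynomial (C : Tensor4 3) (y : Fin 3 → ℝ) (i j : Fin 3) :
    eval y ((acousticPolynomial C).adjugate i j) = (acousticTensor C y).adjugate i j := by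
  rw [← eval_acousticPolynomial, ← RingHom.map_adjugate]
  rfl

theorem isHomogeneous_adjugate {P : Matrix (Fin 3) (Fin 3) (MvPolynomial σ ℝ)}
    (hP : ∀ i j, (P i j).IsHomogeneous 2) (i j : Fin 3) : (P.adjugate i j).IsHomogeneous 4 := by
  rw [Matrix.adjugate_fin_succ_eq_det_submatrix, Matrix.det_fin_two]
  have h : ((-1 : MvPolynomial σ ℝ) ^ (j + i : ℕ)).IsHomogeneous 0 := by
    simpa using ((isHomogeneous_one σ ℝ).neg).pow (j + i : ℕ)
  simpa only [Matrix.submatrix_apply, zero_add] using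
    h.mul (((hP _ _).mul (hP _ _)).sub ((hP _ _).mul (hP _ _)))

/-- If `T(y)` has rank two for all `y ≠ 0`, its adjugate is `c v vᵀ` with a form `c` and a vector
`v` of forms of degree `e ≤ 2`. For `e = 0` the vector `v` is a constant kernel vector; for `e = 1`
it is linear in `y`; for `e = 2` it is quadratic and `c` is a constant. -/
theorem adjugate_acousticTensor_trichotomy {C : Tensor4 3} (hs : HasUsualSymmetries C)
    (hdet : ∀ y, (acousticTensor C y).det = 0)
    (hpos : ∀ y, y ≠ 0 → 0 < (acousticTensor C y).adjugate.trace) :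
    (∃ v : Fin 3 → ℝ, v ≠ 0 ∧ ∀ y, acousticTensor C y *ᵥ v = 0) ∨
    (∃ A : Matrix (Fin 3) (Fin 3) ℝ, A.det ≠ 0 ∧ ∀ y, acousticTensor C y *ᵥ (A *ᵥ y) = 0) ∨
    ∃ (c : ℝ) (Q : Fin 3 → Matrix (Fin 3) (Fin 3) ℝ), 0 < c ∧
      (∀ y i j, (acousticTensor C y).adjugate i j = c * (quadraticMap Q y i * quadraticMap Q y j)) ∧
        (∀ y, acousticTensor C y *ᵥ quadraticMap Q y = 0) ∧
          ∀ y, y ≠ 0 → quadraticMap Q y ≠ 0 := by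
  let D := (acousticPolynomial C).adjugate
  have hsym : ∀ i j, D i j = D j i := fun i j => MvPolynomial.funext fun y => by
    simp only [D, eval_adjugate_acousticPolynomial]
    exact (adjugate_isHermitian (hs.acousticTensor_isHermitian y)).apply_comm i j
  have hrank : ∀ i j k l, D i j * D k l = D i l * D k j := fun i j k l =>
    MvPolynomial.funext fun y => by
      simp only [D, map_mul, eval_adjugate_acousticPolynomial]
      exact adjugate_mul_adjugate_apply (hdet y) i j k l
  have hm : ∃ m, D m m ≠ 0 := by
    by_contra! h
    have h1 := hpos (fun _ => 1) (fun h0 => one_ne_zero (congrFun h0 0))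
    have h2 : (acousticTensor C fun _ => 1).adjugate.trace = 0 :=
      Finset.sum_eq_zero fun i _ => by
        rw [Matrix.diag_apply, ← eval_adjugate_acousticPolynomial]
        exact (congrArg _ (h i)).trans (map_zero _)
    exact h1.ne' h2
  obtain ⟨m, hm⟩ := hm
  obtain ⟨e, c, v, he, hc, hv, hD⟩ := exists_homogeneous_factorisation D hsym hrank
    (isHomogeneous_adjugate (isHomogeneous_acousticPolynomial C)) hm
  have hDy : ∀ y i j, (acousticTensor C y).adjugate i j =
      eval y c * (eval y (v i) * eval y (v j)) := fun y i j => by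
    rw [← eval_adjugate_acousticPolynomial]
    change eval y (D i j) = _
    rw [hD, map_mul, map_mul]
  have htr : ∀ y, (acousticTensor C y).adjugate.trace =
      eval y c * ∑ i, eval y (v i) ^ 2 := fun y => by
    simp only [Matrix.trace, Matrix.diag_apply, hDy, Finset.mul_sum, sq]
  have hker : ∀ y, acousticTensor C y *ᵥ (fun i => eval y (v i)) = 0 := by
    intro y
    by_cases hy : y = 0
    · have : acousticTensor C y = 0 := by
        ext i k; simp [acousticTensor, hy]
      rw [this, Matrix.zero_mulVec]
    have h1 := hpos y hy
    rw [htr] at h1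
    have h2 : acousticTensor C y * (acousticTensor C y).adjugate = 0 := by
      rw [Matrix.mul_adjugate, hdet, zero_smul]
    have hcy : eval y c ≠ 0 := fun h0 => by rw [h0, zero_mul] at h1; exact lt_irrefl _ h1
    obtain ⟨j, hj⟩ : ∃ j, eval y (v j) ≠ 0 := by
      by_contra! h0
      simp [h0] at h1
    funext i
    have h3 := congrFun (congrFun h2 i) j
    simp only [Matrix.mul_apply, hDy] at h3
    have h4 : (eval y c * eval y (v j)) *
        (acousticTensor C y *ᵥ (fun i => eval y (v i))) i = 0 := by
      rw [← Matrix.zero_apply i j, ← h3]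
      simp only [Matrix.mulVec, dotProduct, Finset.mul_sum]
      exact Finset.sum_congr rfl fun k _ => by ring
    exact (mul_eq_zero.1 h4).resolve_left (mul_ne_zero hcy hj)
  have hvne : ∀ y, y ≠ 0 → ∃ i, eval y (v i) ≠ 0 := by
    intro y hy
    by_contra! h0
    have h1 := hpos y hy
    rw [htr] at h1
    simp [h0] at h1
  interval_cases e
  · left
    choose a ha using fun i => eval_of_isHomogeneous_zero (hv i)
    refine ⟨a, fun h0 => ?_, fun y => ?_⟩
    · obtain ⟨i, hi⟩ := hvne (fun _ => 1) fun h0 => one_ne_zero (congrFun h0 0)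
      rw [ha, h0] at hi
      exact hi rfl
    · have := hker y
      simpa only [ha] using this
  · right; left
    choose a ha using fun i => eval_of_isHomogeneous_one (hv i)
    refine ⟨Matrix.of a, fun h0 => ?_, fun y => ?_⟩
    · obtain ⟨y, hy, hy0⟩ := Matrix.exists_mulVec_eq_zero_iff.2 h0
      obtain ⟨i, hi⟩ := hvne y hy
      rw [ha] at hi
      exact hi (congrFun hy0 i)
    · have h1 : (fun i => eval y (v i)) = Matrix.of a *ᵥ y := funext fun i => ha i y
      rw [← h1]
      exact hker y
  · right; right
    choose Q hQ using fun i => eval_of_isHomogeneous_two (hv i)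
    obtain ⟨c₀, hc₀⟩ := eval_of_isHomogeneous_zero hc
    have hvQ : ∀ y, (fun i => eval y (v i)) = quadraticMap Q y := fun y => funext fun i => hQ i y
    refine ⟨c₀, Q, ?_, fun y i j => by rw [hDy, hc₀, hQ, hQ]; rfl, fun y => by rw [← hvQ, hker],
      fun y hy => ?_⟩
    swap
    · obtain ⟨i, hi⟩ := hvne y hy
      exact fun h0 => hi (by rw [hQ]; exact congrFun h0 i)
    have h1 := hpos (fun _ => 1) (fun h0 => one_ne_zero (congrFun h0 0))
    rw [htr, hc₀] at h1
    exact pos_of_mul_pos_left h1 (Finset.sum_nonneg fun i _ => sq_nonneg _)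

end RankOneFactorisation

/-! ### Exchanging the variables -/

section SwappedVariables

variable {d : ℕ} {C : Tensor4 d}

/-- The tensor of the biquadratic form with the roles of `x` and `y` exchanged. -/
def swapTensor (C : Tensor4 d) : Tensor4 d := fun i j k l => C j i l k

theorem HasUsualSymmetries.swapTensor (hs : HasUsualSymmetries C) :
    HasUsualSymmetries (swapTensor C) := fun i j k l => ⟨(hs j i l k).2, (hs j i l k).1⟩

theorem biq_swapTensor (C : Tensor4 d) (x y : Fin d → ℝ) :
    x ⬝ᵥ (acousticTensor (swapTensor C) y *ᵥ x) = y ⬝ᵥ (acousticTensor C x *ᵥ y) := by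
  rw [dotProduct_acousticTensor_mulVec, dotProduct_acousticTensor_mulVec, Finset.sum_comm]
  refine Finset.sum_congr rfl fun i _ => Finset.sum_congr rfl fun j _ => ?_
  rw [Finset.sum_comm]
  refine Finset.sum_congr rfl fun k _ => Finset.sum_congr rfl fun l _ => ?_
  simp only [swapTensor]
  ring

theorem biq_swapTensor_nonneg (hC : ∀ x y, 0 ≤ x ⬝ᵥ (acousticTensor C y *ᵥ x)) (x y : Fin d → ℝ) :
    0 ≤ x ⬝ᵥ (acousticTensor (swapTensor C) y *ᵥ x) := by
  rw [biq_swapTensor]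
  exact hC y x

theorem HasSquareBelow.of_swapTensor (h : HasSquareBelow (swapTensor C)) : HasSquareBelow C := by
  obtain ⟨B, hB0, hB⟩ := h
  refine ⟨Bᵀ, fun h0 => hB0 (Matrix.transpose_eq_zero.1 h0), fun x y => ?_⟩
  have h1 := hB y x
  rwa [biq_swapTensor, Matrix.dotProduct_mulVec, ← Matrix.mulVec_transpose, dotProduct_comm] at h1

/-- Since a positive semidefinite matrix annihilates its isotropic vectors, `x` is in the kernel of
`T(y)` exactly when `y` is in the kernel of the swapped matrix at `x`. -/
theorem acousticTensor_swapTensor_mulVec_eq_zero (hs : HasUsualSymmetries C)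
    (hC : ∀ x y, 0 ≤ x ⬝ᵥ (acousticTensor C y *ᵥ x)) {x y : Fin d → ℝ}
    (h : acousticTensor C y *ᵥ x = 0) : acousticTensor (swapTensor C) x *ᵥ y = 0 :=
  (acousticTensor_posSemidef hs.swapTensor (biq_swapTensor_nonneg hC) x).mulVec_eq_zero
    (by rw [biq_swapTensor, h, dotProduct_zero])

theorem Matrix.eq_zero_of_forall_mulVec {n : Type*} [Fintype n] {M : Matrix n n ℝ}
    (h : ∀ x, M *ᵥ x = 0) : M = 0 := by
  classical
  refine Matrix.ext_of_mulVec_single fun i => ?_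
  rw [h, Matrix.zero_mulVec]

end SwappedVariables

/-! ### Constant and linear kernels -/

section CommonKernel

variable {C : Tensor4 3}

/-- The trace of the adjugate of a positive semidefinite matrix of order three vanishes only if its
rank is at most one, and a value of rank one allows a square to be split off. -/
theorem adjugate_trace_pos (hs : HasUsualSymmetries C)
    (hC : ∀ x y, 0 ≤ x ⬝ᵥ (acousticTensor C y *ᵥ x)) (hn : ¬ HasSquareBelow C) {y : Fin 3 → ℝ}
    (h0 : acousticTensor C y ≠ 0) : 0 < (acousticTensor C y).adjugate.trace := by
  have hp := acousticTensor_posSemidef hs hC y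
  refine lt_of_le_of_ne hp.adjugate_trace_nonneg fun h => hn ?_
  obtain ⟨u, hu, hyu⟩ := hp.exists_eq_vecMulVec (hp.minor_eq_zero h.symm) h0
  exact hasSquareBelow_of_rankOne hs hC hu hyu

theorem eq_zero_of_parallel_of_orthogonal {v w : Fin 3 → ℝ} (hv : v ≠ 0)
    (h : ∀ i j, v i * w j = v j * w i) (h0 : v ⬝ᵥ w = 0) : w = 0 := by
  have hvv : v ⬝ᵥ v ≠ 0 := fun h => hv (dotProduct_self_eq_zero.1 h)
  funext j
  have h1 : (v ⬝ᵥ v) * w j = v j * (v ⬝ᵥ w) := by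
    simp only [dotProduct, Finset.sum_mul, Finset.mul_sum]
    exact Finset.sum_congr rfl fun i _ => by linear_combination v i * h i j
  rw [h0, mul_zero] at h1
  exact (mul_eq_zero.1 h1).resolve_left hvv

theorem vecMulVec_mulVec_eq_smul (a b y : Fin 3 → ℝ) :
    Matrix.vecMulVec a b *ᵥ y = (b ⬝ᵥ y) • a := by
  rw [Matrix.vecMulVec_mulVec, op_smul_eq_smul]

/-- If a fixed vector `v` spans the kernel of every `T(y)`, a multiple of the square of
`(a·x)(a·y)` can be split off, for any `a` orthogonal to `v`. -/
theorem hasSquareBelow_of_common_kernel (hs : HasUsualSymmetries C)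
    (hC : ∀ x y, 0 ≤ x ⬝ᵥ (acousticTensor C y *ᵥ x)) {v : Fin 3 → ℝ} (hv : v ≠ 0)
    (hT : ∀ y, acousticTensor C y *ᵥ v = 0) (hne : ∀ y, y ≠ 0 → acousticTensor C y ≠ 0) :
    HasSquareBelow C := by
  by_contra hn
  have hpos := fun y hy => adjugate_trace_pos hs hC hn (hne y hy)
  obtain ⟨a, ha, hva⟩ := exists_ne_zero_dotProduct_eq_zero v
  refine hn (hasSquareBelow_of_adjugate_mulVec (B := Matrix.vecMulVec a a) hs hC hpos
    (fun h => ha (by simpa using h)) fun y => ?_)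
  rw [vecMulVec_mulVec_eq_smul]
  by_cases hy : y = 0
  · rw [hy, dotProduct_zero, zero_smul, Matrix.mulVec_zero]
  · rw [Matrix.mulVec_smul, adjugate_mulVec_eq_zero (hs.acousticTensor_isHermitian y)
      (Matrix.exists_mulVec_eq_zero_iff.1 ⟨v, hv, hT y⟩) (hpos y hy) (hT y) hv
        (by rwa [dotProduct_comm]), smul_zero]

/-- If the form depends only on the components of `x` orthogonal to `x₀` and of `y` orthogonal to
`y₀`, the square of `(a·x)(b·y)` can be split off, with `a ⊥ x₀` and `b ⊥ y₀`. -/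
theorem hasSquareBelow_of_common_kernels (hs : HasUsualSymmetries C)
    (hC : ∀ x y, 0 ≤ x ⬝ᵥ (acousticTensor C y *ᵥ x)) (h0 : C ≠ 0) {x₀ y₀ : Fin 3 → ℝ}
    (hx₀ : x₀ ≠ 0) (hy₀ : y₀ ≠ 0) (hT : ∀ y, acousticTensor C y *ᵥ x₀ = 0)
    (hS : ∀ x, acousticTensor (swapTensor C) x *ᵥ y₀ = 0) : HasSquareBelow C := by
  by_contra hn
  have hn' : ¬ HasSquareBelow (swapTensor C) := fun h => hn h.of_swapTensor
  have hs' := hs.swapTensor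
  have hC' := biq_swapTensor_nonneg hC
  have hyy : y₀ ⬝ᵥ y₀ ≠ 0 := fun h => hy₀ (dotProduct_self_eq_zero.1 h)
  let W : Submodule ℝ (Fin 3 → ℝ) :=
    { carrier := {y | y₀ ⬝ᵥ y = 0}
      add_mem' := fun {y z} hy hz => by
        rw [Set.mem_ofPred_eq] at hy hz ⊢
        rw [dotProduct_add, hy, hz, add_zero]
      zero_mem' := dotProduct_zero _
      smul_mem' := fun t y hy => by
        rw [Set.mem_ofPred_eq] at hy ⊢
        rw [dotProduct_smul, hy, smul_zero] }
  have hne : ∀ y ∈ W, y ≠ 0 → acousticTensor C y ≠ 0 := by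
    intro y hyW hy hTy
    have hSy : ∀ x, acousticTensor (swapTensor C) x *ᵥ y = 0 := fun x =>
      acousticTensor_swapTensor_mulVec_eq_zero hs hC (by rw [hTy, Matrix.zero_mulVec])
    have hS0 : ∀ x, acousticTensor (swapTensor C) x = 0 := fun x => by
      by_contra hx
      refine hy (eq_zero_of_parallel_of_orthogonal hy₀ (mul_eq_mul_of_mulVec_eq_zero
        (Matrix.exists_mulVec_eq_zero_iff.1 ⟨y₀, hy₀, hS x⟩)
        (adjugate_trace_pos hs' hC' hn' hx) (hS x) (hSy x)) hyW)
    refine h0 (hs.ext_of_biq (fun i j k l => ⟨rfl, rfl⟩) fun x y => ?_)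
    rw [← biq_swapTensor, hS0, Matrix.zero_mulVec, dotProduct_zero]
    have h1 : acousticTensor (0 : Tensor4 3) y = 0 := by ext i k; simp [acousticTensor]
    rw [h1, Matrix.zero_mulVec, dotProduct_zero]
  have hpos := fun y hyW hy => adjugate_trace_pos hs hC hn (hne y hyW hy)
  obtain ⟨a, ha, hxa⟩ := exists_ne_zero_dotProduct_eq_zero x₀
  obtain ⟨b, hb, hyb⟩ := exists_ne_zero_dotProduct_eq_zero y₀
  obtain ⟨ε, hε, h⟩ := exists_mul_sq_le hs hC W hpos (Matrix.vecMulVec a b) fun y hyW => by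
    rw [vecMulVec_mulVec_eq_smul]
    by_cases hy : y = 0
    · rw [hy, dotProduct_zero, zero_smul, Matrix.mulVec_zero]
    · rw [Matrix.mulVec_smul, adjugate_mulVec_eq_zero (hs.acousticTensor_isHermitian y)
        (Matrix.exists_mulVec_eq_zero_iff.1 ⟨x₀, hx₀, hT y⟩) (hpos y hyW hy) (hT y) hx₀
        (by rwa [dotProduct_comm]),
        smul_zero]
  refine hn (hasSquareBelow_of_mul_sq_le (B := Matrix.vecMulVec a b) (fun hB => ?_) hε
    fun x y => ?_)
  · obtain ⟨i, hi⟩ := Function.ne_iff.1 ha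
    obtain ⟨j, hj⟩ := Function.ne_iff.1 hb
    exact mul_ne_zero hi hj (by simpa [Matrix.vecMulVec_apply] using congrFun (congrFun hB i) j)
  · -- both sides are unchanged when `y` is projected orthogonally to `y₀`
    let s := (y₀ ⬝ᵥ y) / (y₀ ⬝ᵥ y₀)
    obtain ⟨z, hz⟩ : ∃ z, y = z + s • y₀ := ⟨y - s • y₀, by simp⟩
    have hzW : z ∈ W := by
      have h1 : y₀ ⬝ᵥ y = y₀ ⬝ᵥ z + s * (y₀ ⬝ᵥ y₀) := by
        conv_lhs => rw [hz, dotProduct_add, dotProduct_smul, smul_eq_mul]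
      rw [div_mul_cancel₀ _ hyy] at h1
      change y₀ ⬝ᵥ z = 0
      linarith
    have h1 := h z hzW x
    have h2 : Matrix.vecMulVec a b *ᵥ y = Matrix.vecMulVec a b *ᵥ z := by
      rw [vecMulVec_mulVec_eq_smul, vecMulVec_mulVec_eq_smul, hz, dotProduct_add, dotProduct_smul,
        hyb, smul_zero, add_zero]
    have h3 : y ⬝ᵥ (acousticTensor (swapTensor C) x *ᵥ y) =
        z ⬝ᵥ (acousticTensor (swapTensor C) x *ᵥ z) := by
      rw [hz, Matrix.mulVec_add, Matrix.mulVec_smul, hS, smul_zero, add_zero, add_dotProduct,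
        smul_dotProduct, (hs'.acousticTensor_isHermitian x).dotProduct_mulVec_comm y₀ z, hS,
        dotProduct_zero, smul_zero, add_zero]
    rw [h2, ← biq_swapTensor, h3, biq_swapTensor]
    exact h1

/-- If the kernel of `T(y)` is spanned by `A y` with `A` invertible, the square of `xᵀ B y` can be
split off for a `B` such that `B y` is always orthogonal to `A y`. -/
theorem hasSquareBelow_of_linear_kernel (hs : HasUsualSymmetries C)
    (hC : ∀ x y, 0 ≤ x ⬝ᵥ (acousticTensor C y *ᵥ x))
    (hpos : ∀ y, y ≠ 0 → 0 < (acousticTensor C y).adjugate.trace)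
    (hdet : ∀ y, (acousticTensor C y).det = 0) {A : Matrix (Fin 3) (Fin 3) ℝ} (hA : A.det ≠ 0)
    (hT : ∀ y, acousticTensor C y *ᵥ (A *ᵥ y) = 0) : HasSquareBelow C := by
  -- `(A y) · (B y) = det A (y · J y) = 0` as `J` is skew
  let J : Matrix (Fin 3) (Fin 3) ℝ := !![0, 1, 0; -1, 0, 0; 0, 0, 0]
  have hJ : Aᵀ * (Aᵀ.adjugate * J) = A.det • J := by
    rw [← mul_assoc, Matrix.mul_adjugate, Matrix.det_transpose, Matrix.smul_mul, one_mul]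
  refine hasSquareBelow_of_adjugate_mulVec (B := Aᵀ.adjugate * J) hs hC hpos (fun h0 => ?_)
    fun y => ?_
  · rw [h0, mul_zero] at hJ
    have h1 := congrFun (congrFun hJ 0) 1
    simp [J] at h1
    exact hA h1.symm
  · by_cases hy : y = 0
    · rw [hy, Matrix.mulVec_zero, Matrix.mulVec_zero]
    · refine adjugate_mulVec_eq_zero (hs.acousticTensor_isHermitian y) (hdet y) (hpos y hy) (hT y)
        (fun h => hA (Matrix.exists_mulVec_eq_zero_iff.1 ⟨y, hy, h⟩)) ?_
      rw [dotProduct_comm, Matrix.dotProduct_mulVec, ← Matrix.mulVec_transpose,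
        Matrix.mulVec_mulVec, hJ]
      simp [J, Matrix.mulVec, dotProduct, Fin.sum_univ_three]
      ring

end CommonKernel

/-! ### Quadratic kernels -/

section QuadraticKernel

variable {C : Tensor4 3}

theorem quadraticMap_smul (Q : Fin 3 → Matrix (Fin 3) (Fin 3) ℝ) (t : ℝ) (y : Fin 3 → ℝ) :
    quadraticMap Q (t • y) = t ^ 2 • quadraticMap Q y := by
  funext i
  simp only [quadraticMap, Matrix.mulVec_smul, dotProduct_smul, smul_dotProduct, smul_eq_mul,
    Pi.smul_apply]
  ring

theorem continuous_quadraticMap (Q : Fin 3 → Matrix (Fin 3) (Fin 3) ℝ) :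
    Continuous (quadraticMap Q) := by
  refine continuous_pi fun i => ?_
  simp only [quadraticMap]
  fun_prop

/-- The Gram determinant of two vectors with respect to a symmetric matrix, in terms of the
cross product. -/
theorem gram_eq_adjugate {M : Matrix (Fin 3) (Fin 3) ℝ} (hM : M.IsHermitian) (x z : Fin 3 → ℝ) :
    (x ⬝ᵥ (M *ᵥ x)) * (z ⬝ᵥ (M *ᵥ z)) - (x ⬝ᵥ (M *ᵥ z)) ^ 2 =
      (x ⨯₃ z) ⬝ᵥ (M.adjugate *ᵥ (x ⨯₃ z)) := by
  have s01 := hM.apply_comm 1 0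
  have s02 := hM.apply_comm 2 0
  have s12 := hM.apply_comm 2 1
  rw [Matrix.adjugate_fin_three, cross_apply]
  simp only [Matrix.mulVec, dotProduct, Fin.sum_univ_three, Matrix.of_apply, Matrix.cons_val,
    s01, s02, s12]
  ring

theorem cross_cross_eq_sub (u v w : Fin 3 → ℝ) :
    u ⨯₃ (v ⨯₃ w) = (u ⬝ᵥ w) • v - (u ⬝ᵥ v) • w := by
  ext i
  fin_cases i <;> simp [cross_apply, dotProduct, Fin.sum_univ_three] <;> ring

/-- If the kernel of `T(y)` is spanned by a quadratic `v(y)` and the swapped matrix is definite at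
some `x₀`, with quadratic form `q`, then the Gram determinant
`(x₀·T x₀)(x·T x) - (x₀·T x)² = c (v·(x₀ × x))²` exhibits `q(y) (x·T(y) x)` as a sum of two squares,
so `x₀·T x` and `v·(x₀ × x)` are multiples of `q`. Then `v` is `q` times a constant vector. -/
theorem exists_common_kernel_of_quadratic (hs : HasUsualSymmetries C)
    (hC : ∀ x y, 0 ≤ x ⬝ᵥ (acousticTensor C y *ᵥ x)) {c : ℝ} (hc : 0 < c)
    {Q : Fin 3 → Matrix (Fin 3) (Fin 3) ℝ}
    (hadj : ∀ y i j, (acousticTensor C y).adjugate i j =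
      c * (quadraticMap Q y i * quadraticMap Q y j))
    (hker : ∀ y, acousticTensor C y *ᵥ quadraticMap Q y = 0)
    (hne : ∀ y, y ≠ 0 → quadraticMap Q y ≠ 0) {x₀ : Fin 3 → ℝ}
    (hx₀ : (acousticTensor (swapTensor C) x₀).det ≠ 0) :
    ∃ m : Fin 3 → ℝ, m ≠ 0 ∧ ∀ y, acousticTensor C y *ᵥ m = 0 := by
  let S := acousticTensor (swapTensor C) x₀
  have hSpos : S.PosDef :=
    (acousticTensor_posSemidef hs.swapTensor (biq_swapTensor_nonneg hC) x₀).posDef_iff_isUnit.2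
      ((Matrix.isUnit_iff_isUnit_det _).2 hx₀.isUnit)
  have hq : ∀ y, y ⬝ᵥ (S *ᵥ y) = x₀ ⬝ᵥ (acousticTensor C y *ᵥ x₀) := fun y => biq_swapTensor C y x₀
  have hfac : ∀ x : Fin 3 → ℝ, ∃ α β : ℝ, ∀ y,
      x₀ ⬝ᵥ (acousticTensor C y *ᵥ x) = α * (y ⬝ᵥ (S *ᵥ y)) ∧
        (x₀ ⨯₃ x) ⬝ᵥ quadraticMap Q y = β * (y ⬝ᵥ (S *ᵥ y)) := by
    intro x
    let A : Matrix (Fin 3) (Fin 3) ℝ := Matrix.of fun k l => ∑ i, ∑ j, x₀ i * C i k j l * x j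
    have hA : ∀ y, y ⬝ᵥ (A *ᵥ y) = x₀ ⬝ᵥ (acousticTensor C y *ᵥ x) := by
      intro y
      simp only [A, acousticTensor, Matrix.mulVec, dotProduct, Matrix.of_apply, Fin.sum_univ_three]
      ring
    let B : Matrix (Fin 3) (Fin 3) ℝ := √c • ∑ i, (x₀ ⨯₃ x) i • Q i
    have hB : ∀ y, y ⬝ᵥ (B *ᵥ y) = √c * ((x₀ ⨯₃ x) ⬝ᵥ quadraticMap Q y) := by
      intro y
      simp only [B, Matrix.smul_mulVec, dotProduct_smul, Matrix.sum_mulVec, dotProduct_sum,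
        smul_eq_mul]
      rfl
    obtain ⟨α, β, h⟩ := exists_eq_mul_of_sq_add_sq (A := A) (B := B)
      (R := acousticTensor (swapTensor C) x) hSpos fun y => by
        have h1 := gram_eq_adjugate (hs.acousticTensor_isHermitian y) x₀ x
        have h2 : (x₀ ⨯₃ x) ⬝ᵥ ((acousticTensor C y).adjugate *ᵥ (x₀ ⨯₃ x)) =
            c * ((x₀ ⨯₃ x) ⬝ᵥ quadraticMap Q y) ^ 2 := by
          simp only [Matrix.mulVec, dotProduct, Fin.sum_univ_three, hadj]
          ring
        rw [hA, hB, hq, biq_swapTensor, mul_pow, Real.sq_sqrt hc.le, ← h2, ← h1]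
        ring
    have hsc : √c ≠ 0 := (Real.sqrt_pos.2 hc).ne'
    refine ⟨α, β / √c, fun y => ⟨by rw [← hA, (h y).1], mul_left_cancel₀ hsc ?_⟩⟩
    rw [← hB, (h y).2]
    field_simp
  choose α β hαβ using fun k : Fin 3 => hfac (Pi.single k 1)
  have hα : ∀ y, acousticTensor C y *ᵥ x₀ = (y ⬝ᵥ (S *ᵥ y)) • α := by
    intro y
    funext k
    have h1 := (hαβ k y).1
    rw [(hs.acousticTensor_isHermitian y).dotProduct_mulVec_comm, single_one_dotProduct] at h1
    rw [h1, Pi.smul_apply, smul_eq_mul, mul_comm]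
  have hβ : ∀ y, quadraticMap Q y ⨯₃ x₀ = (y ⬝ᵥ (S *ᵥ y)) • β := by
    intro y
    funext k
    have h1 := (hαβ k y).2
    rw [dotProduct_comm, triple_product_permutation, triple_product_permutation,
      single_one_dotProduct] at h1
    rw [h1, Pi.smul_apply, smul_eq_mul, mul_comm]
  have hq0 : ∀ y, y ≠ 0 → y ⬝ᵥ (S *ᵥ y) ≠ 0 := fun y hy => by
    simpa using (hSpos.dotProduct_mulVec_pos hy).ne'
  have hαx : ∀ y : Fin 3 → ℝ, y ≠ 0 → α ⬝ᵥ x₀ = 1 := by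
    intro y hy
    refine mul_left_cancel₀ (hq0 y hy) ?_
    rw [mul_one, ← smul_eq_mul, ← smul_dotProduct, ← hα, dotProduct_comm, ← hq]
  have hαv : ∀ y, y ≠ 0 → α ⬝ᵥ quadraticMap Q y = 0 := by
    intro y hy
    refine mul_left_cancel₀ (hq0 y hy) ?_
    rw [mul_zero, ← smul_eq_mul, ← smul_dotProduct, ← hα, dotProduct_comm,
      (hs.acousticTensor_isHermitian y).dotProduct_mulVec_comm, hker, dotProduct_zero]
  -- expand the double cross product `α × (v × x₀)`, using `α·x₀ = 1` and `α·v = 0`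
  have hv : ∀ y, y ≠ 0 → quadraticMap Q y = (y ⬝ᵥ (S *ᵥ y)) • (α ⨯₃ β) := by
    intro y hy
    rw [← LinearMap.map_smul, ← hβ, cross_cross_eq_sub, hαx y hy, hαv y hy, one_smul, zero_smul,
      sub_zero]
  refine ⟨α ⨯₃ β, fun h0 => ?_, fun y => ?_⟩
  · have he : (fun _ => 1 : Fin 3 → ℝ) ≠ 0 := fun h => one_ne_zero (congrFun h 0)
    exact hne _ he (by rw [hv _ he, h0, smul_zero])
  · by_cases hy : y = 0
    · have h1 : acousticTensor C y = 0 := by ext i k; simp [acousticTensor, hy]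
      rw [h1, Matrix.zero_mulVec]
    · have h1 := hker y
      rw [hv y hy, Matrix.mulVec_smul] at h1
      exact (smul_eq_zero.1 h1).resolve_left (hq0 y hy)

/-- When both kernels `v`, `w` are quadratic, `w(v(y))` is a multiple of `y`, since both are in the
kernel of the swapped matrix at `v(y)`; but the odd function `y·w(v(y))` has a zero away from the
origin. -/
theorem false_of_quadratic_kernels (hs : HasUsualSymmetries C)
    (hC : ∀ x y, 0 ≤ x ⬝ᵥ (acousticTensor C y *ᵥ x))
    (hpos : ∀ x, x ≠ 0 → 0 < (acousticTensor (swapTensor C) x).adjugate.trace)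
    (hdet : ∀ x, (acousticTensor (swapTensor C) x).det = 0)
    {P Q : Fin 3 → Matrix (Fin 3) (Fin 3) ℝ}
    (hQ : ∀ y, acousticTensor C y *ᵥ quadraticMap Q y = 0)
    (hQ0 : ∀ y, y ≠ 0 → quadraticMap Q y ≠ 0)
    (hP : ∀ x, acousticTensor (swapTensor C) x *ᵥ quadraticMap P x = 0)
    (hP0 : ∀ x, x ≠ 0 → quadraticMap P x ≠ 0) : False := by
  let g : (Fin 3 → ℝ) → ℝ := fun y => y ⬝ᵥ quadraticMap P (quadraticMap Q y)
  have hg : Continuous g := by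
    have h1 := continuous_quadraticMap P
    have h2 := continuous_quadraticMap Q
    fun_prop
  have hodd : ∀ y, g (-y) = -g y := fun y => by
    have h1 := quadraticMap_smul Q (-1) y
    simp only [neg_smul, one_smul, even_two, Even.neg_pow, one_pow] at h1
    simp only [g, h1, neg_dotProduct]
  obtain ⟨y, hy, hy0⟩ : ∃ y, y ≠ 0 ∧ g y = 0 := by
    have hconn : IsPreconnected ({0}ᶜ : Set (Fin 3 → ℝ)) :=
      (isConnected_compl_singleton_of_one_lt_rank (by simp) 0).isPreconnected
    have he : (fun _ => 1 : Fin 3 → ℝ) ≠ 0 := fun h => one_ne_zero (congrFun h 0)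
    have he' : -(fun _ => 1 : Fin 3 → ℝ) ≠ 0 := neg_ne_zero.2 he
    rcases le_total (g fun _ => 1) 0 with h | h
    · obtain ⟨y, hy, hy0⟩ := hconn.intermediate_value he he' hg.continuousOn
        ⟨h, by rw [hodd]; linarith⟩
      exact ⟨y, hy, hy0⟩
    · obtain ⟨y, hy, hy0⟩ := hconn.intermediate_value he' he hg.continuousOn
        ⟨by rw [hodd]; linarith, h⟩
      exact ⟨y, hy, hy0⟩
  have h1 := acousticTensor_swapTensor_mulVec_eq_zero hs hC (hQ y)
  exact hP0 _ (hQ0 y hy) (eq_zero_of_parallel_of_orthogonal hy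
    (mul_eq_mul_of_mulVec_eq_zero (hdet _) (hpos _ (hQ0 y hy)) h1 (hP _)) hy0)

end QuadraticKernel

/-! ### Every singular form splits off a square -/

section Splitting

theorem hasSquareBelow_of_det_eq_zero (C : Tensor4 3) (hs : HasUsualSymmetries C)
    (hC : ∀ x y, 0 ≤ x ⬝ᵥ (acousticTensor C y *ᵥ x)) (hdet : ∀ y, (acousticTensor C y).det = 0)
    (h0 : C ≠ 0) : HasSquareBelow C := by
  by_contra hn
  have hn' : ¬ HasSquareBelow (swapTensor C) := fun h => hn h.of_swapTensor
  have hs' := hs.swapTensor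
  have hC' := biq_swapTensor_nonneg hC
  have hswap : ∀ {x}, acousticTensor (swapTensor C) x = 0 → ∀ y, acousticTensor C y *ᵥ x = 0 :=
    fun hx y => acousticTensor_swapTensor_mulVec_eq_zero (C := swapTensor C) hs' hC'
      (by rw [hx, Matrix.zero_mulVec])
  have hswap' : ∀ {y}, acousticTensor C y = 0 → ∀ x, acousticTensor (swapTensor C) x *ᵥ y = 0 :=
    fun hy x => acousticTensor_swapTensor_mulVec_eq_zero hs hC (by rw [hy, Matrix.zero_mulVec])
  have hcommon : ∀ {x}, x ≠ 0 → (∀ y, acousticTensor C y *ᵥ x = 0) →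
      acousticTensor (swapTensor C) x = 0 := fun _ h => Matrix.eq_zero_of_forall_mulVec fun y =>
    acousticTensor_swapTensor_mulVec_eq_zero hs hC (h y)
  by_cases hS : ∀ x, x ≠ 0 → acousticTensor (swapTensor C) x ≠ 0
  swap
  · push Not at hS
    obtain ⟨x₀, hx₀, hSx₀⟩ := hS
    by_cases hT : ∀ y, y ≠ 0 → acousticTensor C y ≠ 0
    · exact hn (hasSquareBelow_of_common_kernel hs hC hx₀ (hswap hSx₀) hT)
    · push Not at hT
      obtain ⟨y₀, hy₀, hTy₀⟩ := hT
      exact hn (hasSquareBelow_of_common_kernels hs hC h0 hx₀ hy₀ (hswap hSx₀) (hswap' hTy₀))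
  by_cases hT : ∀ y, y ≠ 0 → acousticTensor C y ≠ 0
  swap
  · push Not at hT
    obtain ⟨y₀, hy₀, hTy₀⟩ := hT
    exact hn' (hasSquareBelow_of_common_kernel hs' hC' hy₀ (hswap' hTy₀) hS)
  have hpos := fun y hy => adjugate_trace_pos hs hC hn (hT y hy)
  obtain ⟨v, hv, hTv⟩ | ⟨A, hA, hTA⟩ | ⟨c, Q, hc, hadj, hQ, hQ0⟩ :=
    adjugate_acousticTensor_trichotomy hs hdet hpos
  · exact hS v hv (hcommon hv hTv)
  · exact hn (hasSquareBelow_of_linear_kernel hs hC hpos hdet hA hTA)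
  by_cases hdet' : ∀ x, (acousticTensor (swapTensor C) x).det = 0
  swap
  · push Not at hdet'
    obtain ⟨x₀, hx₀⟩ := hdet'
    obtain ⟨m, hm, hTm⟩ := exists_common_kernel_of_quadratic hs hC hc hadj hQ hQ0 hx₀
    exact hS m hm (hcommon hm hTm)
  have hpos' := fun x hx => adjugate_trace_pos hs' hC' hn' (hS x hx)
  obtain ⟨v, hv, hSv⟩ | ⟨A, hA, hSA⟩ | ⟨c', P, hc', hadj', hP, hP0⟩ :=
    adjugate_acousticTensor_trichotomy hs' hdet' hpos'
  · refine hT v hv (Matrix.eq_zero_of_forall_mulVec fun x => ?_)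
    exact acousticTensor_swapTensor_mulVec_eq_zero (C := swapTensor C) hs' hC' (hSv x)
  · exact hn' (hasSquareBelow_of_linear_kernel hs' hC' hpos' hdet' hA hSA)
  · exact false_of_quadratic_kernels hs hC hpos' hdet' hQ hQ0 hP hP0

end Splitting

theorem theorem2p2 :
    (∀ C : Tensor4 3, HasUsualSymmetries C → IsQuasiconvex (tensorForm C) →
      (∀ y : Fin 3 → ℝ, (acousticTensor C y).det = 0) →
        IsPolyconvex (tensorForm C) ∧ IsSumOfSquaresOfBilinear C) ∧
    (∀ d : ℕ, 4 ≤ d → ∃ C : Tensor4 d, HasUsualSymmetries C ∧ IsQuasiconvex (tensorForm C) ∧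
      (∀ y : Fin d → ℝ, (acousticTensor C y).det = 0) ∧
        ¬ IsPolyconvex (tensorForm C) ∧ ¬ IsSumOfSquaresOfBilinear C) := by
  refine ⟨fun C hs hq hdet => ?_, exists_counterexample⟩
  have h := isSumOfSquaresOfBilinear_of_hasSquareBelow hasSquareBelow_of_det_eq_zero hs
    hq.biq_nonneg hdet
  exact ⟨h.isPolyconvex hs, h⟩
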